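/- Let $1\le k<\frac n2$, $\tau>0$, and let $(M^n,g)$ be a Riemannian manifold that is asymptotically flat of decay order $\tau$: for some compact $K\subset M$ and $R>0$ there is a diffeomorphism $M\setminus K\cong\{x\in\mathbb R^n:|x|>R\}$, in whose coordinates $g_{ij}=\delta_{ij}+\sigma_{ij}$ with $|\sigma_{ij}|+r|\partial\sigma_{ij}|+r^2|\partial^2\sigma_{ij}|=O(r^{-\tau})$, $r=|x|$. Orient the end by these coordinates. Let $S_r=\{|x|=r\}$, let $\nu=\nabla_g r/|\nabla_g r|_g$ be its outward $g$-unit normal, and let $d\sigma^g=\iota_\nu\,dV_g|_{S_r}$ be the induced area form. The curvature tensor has the sign for which ${R_{ij}}^{ij}$ is the scalar curvature, $\delta^{\cdots}_{\cdots}$ is the generalized Kronecker delta, and $$\mathcal E^{(k)i}{}_j=-\frac1{2^{k+1}}\,\delta^{i\,i_1\cdots i_{2k}}_{j\,j_1\cdots j_{2k}}\,{R_{i_1i_2}}^{j_1j_2}\cdots{R_{i_{2k-1}i_{2k}}}^{j_{2k-1}j_{2k}}$$ is the $k$-th Lovelock curvature. On the unit sphere bundle of the end let $$\Phi_k=\sum_{\alpha_1,\dots,\alpha_{n-1}=1}^{n-1}\delta^{\alpha_1\cdots\alpha_{n-1}}_{1\,\cdots\,n-1}\;\Omega_{\alpha_1\alpha_2}\wedge\cdots\wedge\Omega_{\alpha_{2k-1}\alpha_{2k}}\wedge\omega_{\alpha_{2k+1}n}\wedge\cdots\wedge\omega_{\alpha_{n-1}n},$$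 where $e_1,\dots,e_n$ is a positively oriented orthonormal frame with $e_n=v$ at the point $(x,v)$, with dual coframe $\omega_\gamma$, $\Omega_{\alpha\beta}=\frac12{R_{\alpha\beta}}^{\gamma\delta}\omega_\gamma\wedge\omega_\delta$ and $\omega_{\alpha n}=g(\nabla e_\alpha,e_n)=-g(e_\alpha,\nabla e_n)$. View $\nu$ as a section of the sphere bundle. Then, for every choice of such frames with $e_n=\nu$, as $(n-1)$-forms on $S_r$ and uniformly on $S_r$ as $r\to\infty$, $$r^{n-2k}\,\nu^*(\Phi_k)=-2\,(n-2k-1)!\;\mathcal E^{(k)}\!\left(r\tfrac{\partial}{\partial r},\tfrac{\partial}{\partial r}\right)d\sigma^g+O\!\left(r^{-(k+1)\tau-2k+1}\right).$$ Consequently, with $\omega_{n-1}$ the volume of the unit $(n-1)$-sphere, the integrands of the Chern mass $m_k^C$ and of the intrinsic mass $m_I^k$ satisfy, uniformly on $S_r$, $$\frac{r^{n-2k}\,\nu^*(\Phi_k)}{2^k(n-1)!\,\omega_{n-1}}=-\frac{(n-2k-1)!}{2^{k-1}(n-1)!\,\omega_{n-1}}\,\mathcal E^{(k)}\!\left(r\tfrac{\partial}{\partial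 r},\nu\right)d\sigma^g+O\!\left(r^{-(k+1)\tau-2k+1}\right),$$ and if $\tau>\frac{n-2k}{k+1}$, then the integral over $S_r$ of the absolute value of the difference of these two integrands tends to $0$ as $r\to\infty$. -/

import Mathlib

open scoped Manifold ContDiff Topology ENNReal
open Filter MeasureTheory

namespace ChernMass

/-! ### Riemannian geometry in one coordinate chart

The dimension is `n = m + 1`, coordinates are indexed by `Fin (m + 1)`, and a metric is given by its
matrix of components `G x i j = g_ij(x)`. -/

/-- Euclidean `n`-space. -/
abbrev Euc (n : ℕ) := EuclideanSpace ℝ (Fin n)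

/-- The `i`-th standard basis vector. -/
noncomputable def stdVec {n : ℕ} (i : Fin n) : Euc n := EuclideanSpace.single i (1 : ℝ)

/-- The partial derivative `∂_i f`. -/
noncomputable def pd {n : ℕ} (i : Fin n) (f : Euc n → ℝ) (x : Euc n) : ℝ :=
  fderiv ℝ f x (stdVec i)

/-- `g(u, v)` at the point `x`. -/
noncomputable def metricAt {n : ℕ} (G : Euc n → Matrix (Fin n) (Fin n) ℝ) (x u v : Euc n) : ℝ :=
  ∑ i, ∑ j, G x i j * u i * v j

/-- Christoffel symbols `Γ^l_{ij} = ½ g^{lp} (∂_i g_{jp} + ∂_j g_{ip} - ∂_p g_{ij})`. -/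
noncomputable def christoffel {n : ℕ} (G : Euc n → Matrix (Fin n) (Fin n) ℝ)
    (l i j : Fin n) (x : Euc n) : ℝ :=
  (1 / 2) * ∑ p, (G x)⁻¹ l p *
    (pd i (fun y => G y j p) x + pd j (fun y => G y i p) x - pd p (fun y => G y i j) x)

/-- Components `∂_i Γ^p_{jl} - ∂_j Γ^p_{il} + Γ^p_{iq} Γ^q_{jl} - Γ^p_{jq} Γ^q_{il}` of
`(∇_i ∇_j - ∇_j ∇_i) ∂_l = (riemannUp p l i j) ∂_p`. -/
noncomputable def riemannUp {n : ℕ} (G : Euc n → Matrix (Fin n) (Fin n) ℝ)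
    (p l i j : Fin n) (x : Euc n) : ℝ :=
  pd i (christoffel G p j l) x - pd j (christoffel G p i l) x
    + ∑ q, (christoffel G p i q x * christoffel G q j l x
      - christoffel G p j q x * christoffel G q i l x)

/-- The curvature tensor `R_{ijkl} = g((∇_i ∇_j - ∇_j ∇_i) ∂_l, ∂_k)`; with this sign `R_{ijij} > 0`
on round spheres and `g^{ik} g^{jl} R_{ijkl}` is the scalar curvature. -/
noncomputable def riemann {n : ℕ} (G : Euc n → Matrix (Fin n) (Fin n) ℝ)
    (i j k l : Fin n) (x : Euc n) : ℝ :=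
  ∑ p, G x k p * riemannUp G p l i j x

/-- `R_{ij}^{kl} = g^{kp} g^{lq} R_{ijpq}`. -/
noncomputable def riemannMixed {n : ℕ} (G : Euc n → Matrix (Fin n) (Fin n) ℝ)
    (i j k l : Fin n) (x : Euc n) : ℝ :=
  ∑ p, ∑ q, (G x)⁻¹ k p * (G x)⁻¹ l q * riemann G i j p q x

/-- `R(a, b, c, d) = R_{ijkl} a^i b^j c^k d^l`. -/
noncomputable def riemannAt {n : ℕ} (G : Euc n → Matrix (Fin n) (Fin n) ℝ)
    (x a b c d : Euc n) : ℝ :=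
  ∑ i, ∑ j, ∑ k, ∑ l, riemann G i j k l x * a i * b j * c k * d l

/-- The generalized Kronecker delta, a determinant of ordinary ones. -/
def genDelta {ι : Type*} [DecidableEq ι] {r : ℕ} (a b : Fin r → ι) : ℝ :=
  Matrix.det (Matrix.of fun s t : Fin r => if b s = a t then (1 : ℝ) else 0)

/-! Positions in a list of length `m ≥ 2k`: the `j`-th pair is `(2j, 2j+1)` for `j < k`, and the
remaining positions are `2k + l` for `l < m - 2k` (counting from zero). -/

/-- First position of the `j`-th pair. -/
def fstPos {m k : ℕ} (hk : 2 * k ≤ m) (j : Fin k) : Fin m := ⟨2 * j, by omega⟩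

/-- Second position of the `j`-th pair. -/
def sndPos {m k : ℕ} (hk : 2 * k ≤ m) (j : Fin k) : Fin m := ⟨2 * j + 1, by omega⟩

/-- The `l`-th position after the `k` pairs. -/
def tailPos {m k : ℕ} (hk : 2 * k ≤ m) (l : Fin (m - 2 * k)) : Fin m := ⟨2 * k + l, by omega⟩

/-- The Lovelock curvature
`E^i_j = - 2^{-(k+1)} δ^{i i_1 … i_{2k}}_{j j_1 … j_{2k}} R_{i_1 i_2}^{j_1 j_2} ⋯` (for `k ≥ 1`). -/
noncomputable def lovelockMixed {n : ℕ} (k : ℕ) (G : Euc n → Matrix (Fin n) (Fin n) ℝ)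
    (i j : Fin n) (x : Euc n) : ℝ :=
  -(1 / 2 ^ (k + 1)) * ∑ a : Fin (2 * k) → Fin n, ∑ b : Fin (2 * k) → Fin n,
    genDelta (Fin.cons i a : Fin (2 * k + 1) → Fin n) (Fin.cons j b : Fin (2 * k + 1) → Fin n) *
      ∏ s : Fin k, riemannMixed G (a (fstPos le_rfl s)) (a (sndPos le_rfl s))
        (b (fstPos le_rfl s)) (b (sndPos le_rfl s)) x

/-- The Lovelock curvature as a bilinear form, `E(u, v) = g_{ip} E^p_j u^i v^j`. -/
noncomputable def lovelockAt {n : ℕ} (k : ℕ) (G : Euc n → Matrix (Fin n) (Fin n) ℝ)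
    (x u v : Euc n) : ℝ :=
  ∑ i, ∑ j, (∑ p, G x i p * lovelockMixed k G p j x) * u i * v j

/-! ### Chern's form on the unit sphere bundle, and its pull-back -/

/-- The wedge product `Θ_1 ∧ ⋯ ∧ Θ_k ∧ θ_1 ∧ ⋯ ∧ θ_{m-2k}` of `k` two-forms and `m - 2k` one-forms,
evaluated on `m` vectors (normalized by `(θ_1 ∧ ⋯ ∧ θ_m)(X) = det (θ_i (X_j))`). -/
noncomputable def wedge {V : Type*} {m k : ℕ} (hk : 2 * k ≤ m) (Θ : Fin k → V → V → ℝ)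
    (θ : Fin (m - 2 * k) → V → ℝ) (X : Fin m → V) : ℝ :=
  (1 / 2 ^ k) * ∑ π : Equiv.Perm (Fin m), ((Equiv.Perm.sign π : ℤ) : ℝ) *
    ((∏ s, Θ s (X (π (fstPos hk s))) (X (π (sndPos hk s)))) * ∏ l, θ l (X (π (tailPos hk l))))

/-- `e_1, …, e_n` is a positively oriented `g`-orthonormal frame at `x` with `e_n = v`. -/
def IsAdaptedFrame {m : ℕ} (G : Euc (m + 1) → Matrix (Fin (m + 1)) (Fin (m + 1)) ℝ)
    (x v : Euc (m + 1)) (e : Fin (m + 1) → Euc (m + 1)) : Prop :=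
  (∀ a b, metricAt G x (e a) (e b) = if a = b then 1 else 0) ∧
    0 < Matrix.det (Matrix.of fun i a => e a i) ∧ e (Fin.last m) = v

/-- The connection map of the Levi-Civita connection: the covariant derivative at `(x, v)` of a curve
in the tangent bundle with velocity `(ξ, η)`, namely `η^l + Γ^l_{ij} ξ^i v^j`. -/
noncomputable def connectionMap {n : ℕ} (G : Euc n → Matrix (Fin n) (Fin n) ℝ)
    (x v : Euc n) (Z : Euc n × Euc n) : Euc n :=
  WithLp.toLp 2 fun l => Z.2 l + ∑ i, ∑ j, christoffel G l i j x * Z.1 i * v j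

/-- The connection form `ω_{αn} = g(∇ e_α, e_n) = - g(e_α, ∇ e_n)` on the sphere bundle, where
`e_n = v` is the tautological unit vector at `(x, v)`. -/
noncomputable def connForm {n : ℕ} (G : Euc n → Matrix (Fin n) (Fin n) ℝ)
    (x v eα : Euc n) (Z : Euc n × Euc n) : ℝ :=
  -metricAt G x eα (connectionMap G x v Z)

/-- The curvature form `Ω_{αβ} = ½ R_{αβ}^{γδ} ω_γ ∧ ω_δ` of an orthonormal frame `e` with dual
coframe `ω_γ = g(e_γ, ·)`, on the sphere bundle (tangent vectors are first projected to the base). -/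
noncomputable def curvForm {n : ℕ} (G : Euc n → Matrix (Fin n) (Fin n) ℝ)
    (x : Euc n) (e : Fin n → Euc n) (α β : Fin n) (Z W : Euc n × Euc n) : ℝ :=
  (1 / 2) * ∑ γ, ∑ δ, riemannAt G x (e α) (e β) (e γ) (e δ) *
    (metricAt G x (e γ) Z.1 * metricAt G x (e δ) W.1
      - metricAt G x (e γ) W.1 * metricAt G x (e δ) Z.1)

/-- Chern's form
`Φ_k = ε^{α_1 … α_{n-1}} Ω_{α_1 α_2} ∧ ⋯ ∧ Ω_{α_{2k-1} α_{2k}} ∧ ω_{α_{2k+1} n} ∧ ⋯ ∧ ω_{α_{n-1} n}`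
at the point `(x, v)` of the unit sphere bundle, written in an adapted frame `e` at `(x, v)` and
evaluated on `n - 1` tangent vectors `(ξ, η)` of the sphere bundle. -/
noncomputable def chernForm {m k : ℕ} (hk : 2 * k ≤ m)
    (G : Euc (m + 1) → Matrix (Fin (m + 1)) (Fin (m + 1)) ℝ) (x v : Euc (m + 1))
    (e : Fin (m + 1) → Euc (m + 1)) (Z : Fin m → Euc (m + 1) × Euc (m + 1)) : ℝ :=
  ∑ α : Fin m → Fin m, genDelta α id *
    wedge hk
      (fun s => curvForm G x e (α (fstPos hk s)).castSucc (α (sndPos hk s)).castSucc)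
      (fun l => connForm G x v (e (α (tailPos hk l)).castSucc)) Z

/-- The outward unit normal `ν = ∇_g r / |∇_g r|_g` of the coordinate spheres, where `r = ‖x‖`, so
that `∂_j r = x_j / r`. -/
noncomputable def unitNormal {n : ℕ} (G : Euc n → Matrix (Fin n) (Fin n) ℝ) (x : Euc n) : Euc n :=
  WithLp.toLp 2 fun i => (∑ j, (G x)⁻¹ i j * (x j / ‖x‖)) /
    Real.sqrt (∑ p, ∑ q, (G x)⁻¹ p q * (x p / ‖x‖) * (x q / ‖x‖))

/-- The pull-back `ν^* Φ_k` under the section `x ↦ (x, ν(x))` of the sphere bundle. -/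
noncomputable def pulledChernForm {m k : ℕ} (hk : 2 * k ≤ m)
    (G : Euc (m + 1) → Matrix (Fin (m + 1)) (Fin (m + 1)) ℝ) (x : Euc (m + 1))
    (e : Fin (m + 1) → Euc (m + 1)) (X : Fin m → Euc (m + 1)) : ℝ :=
  chernForm hk G x (unitNormal G x) e fun s => (X s, fderiv ℝ (unitNormal G) x (X s))

/-- The area form `dσ^g` which the volume form `√(det g) dx^1 ∧ ⋯ ∧ dx^n` induces on the coordinate
spheres: the interior product with `ν`.  In an adapted frame it is `(-1)^{n-1} ω_1 ∧ ⋯ ∧ ω_{n-1}`. -/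
noncomputable def areaForm {m : ℕ} (G : Euc (m + 1) → Matrix (Fin (m + 1)) (Fin (m + 1)) ℝ)
    (x : Euc (m + 1)) (X : Fin m → Euc (m + 1)) : ℝ :=
  Real.sqrt (G x).det *
    Matrix.det (Matrix.of fun i a => (Fin.cons (unitNormal G x) X : Fin (m + 1) → Euc (m + 1)) a i)

/-- The coordinate field `∂_r`. -/
noncomputable def radial {n : ℕ} (x : Euc n) : Euc n := ‖x‖⁻¹ • x

/-- The volume `ω_{n-1}` of the standard unit sphere in Euclidean `n`-space. -/
noncomputable def sphereVol (n : ℕ) : ℝ := ((volume : Measure (Euc n)).toSphere).real Set.univ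

/-- The integrand `(2^k (n-1)! ω_{n-1})⁻¹ r^{n-2k} ν^* Φ_k` of the Chern mass, `n = m + 1`. -/
noncomputable def chernMassIntegrand {m k : ℕ} (hk : 2 * k ≤ m)
    (G : Euc (m + 1) → Matrix (Fin (m + 1)) (Fin (m + 1)) ℝ) (x : Euc (m + 1))
    (e : Fin (m + 1) → Euc (m + 1)) (X : Fin m → Euc (m + 1)) : ℝ :=
  1 / (2 ^ k * (m.factorial : ℝ) * sphereVol (m + 1)) *
    (‖x‖ ^ (m + 1 - 2 * k) * pulledChernForm hk G x e X)

/-- The integrand `-(n-2k-1)! / (2^{k-1} (n-1)! ω_{n-1}) E(r ∂_r, ν) dσ^g` of the intrinsic mass,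
`n = m + 1` and `k ≥ 1`. -/
noncomputable def intrinsicMassIntegrand {m : ℕ} (k : ℕ)
    (G : Euc (m + 1) → Matrix (Fin (m + 1)) (Fin (m + 1)) ℝ) (x : Euc (m + 1))
    (X : Fin m → Euc (m + 1)) : ℝ :=
  -(((m - 2 * k).factorial : ℝ) / (2 ^ (k - 1) * (m.factorial : ℝ) * sphereVol (m + 1))) *
    (lovelockAt k G x (‖x‖ • radial x) (unitNormal G x) * areaForm G x X)

/-- The vectors `X_i` are tangent at `x` to the coordinate sphere through `x`. -/
def IsTangent {m n : ℕ} (x : Euc n) (X : Fin m → Euc n) : Prop := ∀ i, inner ℝ x (X i) = 0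

/-- The Euclidean norm `|β|` of the restriction of an `(n-1)`-form `β` to the coordinate sphere
through `x`, `n = m + 1`: if `β = f dσ^δ` there, with `dσ^δ` the Euclidean area form, it is `|f|`. -/
noncomputable def tangNorm {m : ℕ} (x : Euc (m + 1)) (β : (Fin m → Euc (m + 1)) → ℝ) : ℝ≥0∞ :=
  ⨆ X : Fin m → Euc (m + 1), ⨆ _ : IsTangent x X ∧ ∀ i, ‖X i‖ ≤ 1, ENNReal.ofReal |β X|

/-- The total mass `∫_{S_r} |β| dσ^δ` of a form `β` of degree `n - 1` on the sphere of radius `r`. -/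
noncomputable def sphereMass {m : ℕ} (β : Euc (m + 1) → (Fin m → Euc (m + 1)) → ℝ) (r : ℝ) : ℝ≥0∞ :=
  ENNReal.ofReal (r ^ m) * ∫⁻ θ, tangNorm (r • (θ : Euc (m + 1))) (β (r • (θ : Euc (m + 1))))
    ∂(volume : Measure (Euc (m + 1))).toSphere

/-! ### Asymptotically flat manifolds -/

variable {n : ℕ} {M : Type*} [TopologicalSpace M] [ChartedSpace (Euc n) M]

/-- The components `g_ij = g(∂_i, ∂_j)` of a Riemannian metric in the coordinates of a chart `φ`. -/
noncomputable def components [IsManifold 𝓘(ℝ, Euc n) ∞ M]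
    (g : Bundle.ContMDiffRiemannianMetric 𝓘(ℝ, Euc n) ∞ (Euc n)
      (fun p : M => TangentSpace 𝓘(ℝ, Euc n) p))
    (φ : OpenPartialHomeomorph M (Euc n)) (x : Euc n) : Matrix (Fin n) (Fin n) ℝ :=
  Matrix.of fun i j => g.inner (φ.symm x)
    (mfderiv 𝓘(ℝ, Euc n) 𝓘(ℝ, Euc n) φ.symm x (stdVec i : Euc n))
    (mfderiv 𝓘(ℝ, Euc n) 𝓘(ℝ, Euc n) φ.symm x (stdVec j : Euc n))

/-- `g` is asymptotically flat of decay order `τ` in the coordinates at infinity `φ`: a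
diffeomorphism of the complement of a compact set onto the exterior of the ball of radius `R`. -/
structure IsAFChart [IsManifold 𝓘(ℝ, Euc n) ∞ M]
    (g : Bundle.ContMDiffRiemannianMetric 𝓘(ℝ, Euc n) ∞ (Euc n)
      (fun p : M => TangentSpace 𝓘(ℝ, Euc n) p))
    (τ R : ℝ) (φ : OpenPartialHomeomorph M (Euc n)) : Prop where
  radius_pos : 0 < R
  smooth : φ ∈ IsManifold.maximalAtlas 𝓘(ℝ, Euc n) ∞ M
  compact_compl : IsCompact φ.sourceᶜ
  target_eq : φ.target = {x | R < ‖x‖}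
  decay_zero : ∀ i j, (fun x => components g φ x i j - if i = j then 1 else 0)
    =O[Bornology.cobounded (Euc n)] fun x => ‖x‖ ^ (-τ)
  decay_one : ∀ p i j, (fun x => pd p (fun y => components g φ y i j) x)
    =O[Bornology.cobounded (Euc n)] fun x => ‖x‖ ^ (-τ - 1)
  decay_two : ∀ q p i j, (fun x => pd q (pd p (fun y => components g φ y i j)) x)
    =O[Bornology.cobounded (Euc n)] fun x => ‖x‖ ^ (-τ - 2)

end ChernMass

open ChernMass

/-! Write n = m + 1 and r = ‖x‖. The unit normal satisfies ν = x/r + O(r^{-τ}), with derivatives one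
order smaller, and the Christoffel symbols are O(r^{-τ-1}). For X tangent to the coordinate sphere
this gives ∇_X ν = X/r + O(r^{-τ-1})|X| (`connectionMap_unitNormal`, `shapeError`). Hence ω_{αn} =
-ω_α/r up to an error of relative size r^{-τ}.

Replacing every ω_{αn} in ν^*Φ_k by -ω_α/r leaves pure algebra. Tangent vectors are g-orthogonal to
ν, so only tangential curvature components enter. The product of the two permutation symbols is a
generalized delta, and contracting its n-1-2k tail indices gives (n-1-2k)! (`sum_genDelta_wedge`).
The remaining contraction of k curvature factors is -2^{k+1} E(ν,ν) (`lovelockAt_eq_frame`), since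
an index equal to n would be repeated in the delta. The area form is (-1)^{n-1} times the
determinant of the tangential coframe (`areaForm_eq_det`). Together these give `leading_term_eq`,
with the factor -2(n-2k-1)!.

The error of the replacement contains k curvature forms of size r^{-τ-2}, n-1-2k one-forms of size
1/r and one relative error r^{-τ}. Multiplied by r^{n-2k} it has order -(k+1)τ-2k+1
(`abs_wedge_sub_le`, `rpow_collect`). All bounds are uniform in the frame, because the components of
an orthonormal frame are controlled by g^{-1} (`IsAdaptedFrame.abs_le`).

Since E = O(r^{-k(τ+2)}) and ν - ∂_r = O(r^{-τ}), exchanging ν and ∂_r in the arguments of E costs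
an error of the same order (`expansion_congr`). Integration over S_r multiplies by r^{n-1}, and the
resulting exponent is negative exactly when τ > (n-2k)/(k+1). -/

namespace ChernMass

/-! ### Symmetry and smoothness of the metric components in a chart -/

section Components
variable {n : ℕ} {M : Type*} [TopologicalSpace M] [ChartedSpace (Euc n) M]
  [IsManifold 𝓘(ℝ, Euc n) ∞ M]

theorem components_symm
    (g : Bundle.ContMDiffRiemannianMetric 𝓘(ℝ, Euc n) ∞ (Euc n)
      (fun p : M => TangentSpace 𝓘(ℝ, Euc n) p))
    (φ : OpenPartialHomeomorph M (Euc n)) (x : Euc n) (i j : Fin n) :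
    components g φ x i j = components g φ x j i := by
  simp only [components, Matrix.of_apply]
  exact g.symm _ _ _

theorem contDiffAt_components
    (g : Bundle.ContMDiffRiemannianMetric 𝓘(ℝ, Euc n) ∞ (Euc n)
      (fun p : M => TangentSpace 𝓘(ℝ, Euc n) p))
    {φ : OpenPartialHomeomorph M (Euc n)}
    (hφ : φ ∈ IsManifold.maximalAtlas 𝓘(ℝ, Euc n) ∞ M) {x : Euc n} (hx : x ∈ φ.target)
    (i j : Fin n) : ContDiffAt ℝ ∞ (fun y => components g φ y i j) x := by
  have hsymm : ContMDiffOn 𝓘(ℝ, Euc n) 𝓘(ℝ, Euc n) ∞ φ.symm φ.target :=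
    contMDiffOn_symm_of_mem_maximalAtlas hφ
  have hbase : ContMDiffAt 𝓘(ℝ, Euc n) 𝓘(ℝ, Euc n) ∞ φ.symm x :=
    hsymm.contMDiffAt (φ.open_target.mem_nhds hx)
  have hvec : ∀ v : Euc n, ContMDiffAt 𝓘(ℝ, Euc n) (𝓘(ℝ, Euc n).prod 𝓘(ℝ, Euc n)) ∞
      (fun y => (⟨φ.symm y, mfderiv 𝓘(ℝ, Euc n) 𝓘(ℝ, Euc n) φ.symm y v⟩ :
        TangentBundle 𝓘(ℝ, Euc n) M)) x := by
    intro v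
    -- The field y ↦ d(φ⁻¹)_y v is the tangent map of φ⁻¹ composed with the constant section v.
    have h1 := hsymm.contMDiffOn_tangentMapWithin (m := ∞) (by simp)
      φ.open_target.uniqueMDiffOn
    have h2 : ContMDiffAt 𝓘(ℝ, Euc n) (𝓘(ℝ, Euc n).prod 𝓘(ℝ, Euc n)) ∞
        (fun y : Euc n => (⟨y, v⟩ : TangentBundle 𝓘(ℝ, Euc n) (Euc n))) x := by
      rw [Bundle.contMDiffAt_totalSpace]
      refine ⟨contMDiffAt_id, ?_⟩
      simp
      exact contMDiffAt_const
    have h3 := (h1 ⟨x, v⟩ (by simpa using hx)).comp (s := φ.target) x h2.contMDiffWithinAt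
      (fun y hy => by simpa using hy)
    refine (h3.contMDiffAt (φ.open_target.mem_nhds hx)).congr_of_eventuallyEq ?_
    filter_upwards [φ.open_target.mem_nhds hx] with y hy
    simp only [Function.comp, tangentMapWithin]
    rw [mfderivWithin_of_isOpen φ.open_target hy]
  have hg := (g.contMDiff (φ.symm x)).comp x hbase
  have key := ContMDiffAt.clm_bundle_apply₂ (F₁ := Euc n) (F₂ := Euc n)
    (E₁ := fun p : M => TangentSpace 𝓘(ℝ, Euc n) p)
    (E₂ := fun p : M => TangentSpace 𝓘(ℝ, Euc n) p)
    (E₃ := fun p : M => (Bundle.Trivial M ℝ) p) (F₃ := ℝ) hg (hvec (stdVec i)) (hvec (stdVec j))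
  simp only [Bundle.contMDiffAt_totalSpace] at key
  exact key.2.contDiffAt

end Components

/-! ### Symbol calculus at infinity -/

section Symbols
variable {n : ℕ} {f g : Euc n → ℝ} {s t : ℝ}

open Asymptotics Bornology

theorem eventually_lt_norm (r : ℝ) : ∀ᶠ x in cobounded (Euc n), r < ‖x‖ :=
  tendsto_norm_cobounded_atTop.eventually_gt_atTop r

/-- Exteriors of balls are open and form a basis at infinity. This allows eventual identities to be
differentiated. -/
theorem eventually_eventually_nhds_cobounded {p : Euc n → Prop}
    (h : ∀ᶠ x in cobounded (Euc n), p x) :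
    ∀ᶠ x in cobounded (Euc n), ∀ᶠ y in 𝓝 x, p y := by
  obtain ⟨r, -, hr⟩ := (hasBasis_cobounded_norm (E := Euc n)).eventually_iff.mp h
  filter_upwards [eventually_lt_norm r] with x hx
  filter_upwards [(isOpen_lt continuous_const continuous_norm).mem_nhds hx] with y hy
  exact hr (le_of_lt hy)

theorem isBigO_rpow_of_le (h : s ≤ t) :
    (fun x : Euc n => ‖x‖ ^ s) =O[cobounded (Euc n)] fun x => ‖x‖ ^ t := by
  refine IsBigO.of_bound 1 ?_
  filter_upwards [eventually_lt_norm 1] with x hx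
  rw [one_mul, Real.norm_of_nonneg (by positivity), Real.norm_of_nonneg (by positivity)]
  exact Real.rpow_le_rpow_of_exponent_le hx.le h

theorem isBigO_mul_rpow (hf : f =O[cobounded (Euc n)] fun x => ‖x‖ ^ s)
    (hg : g =O[cobounded (Euc n)] fun x => ‖x‖ ^ t) {u : ℝ} (h : s + t ≤ u) :
    (fun x => f x * g x) =O[cobounded (Euc n)] fun x => ‖x‖ ^ u := by
  refine ((hf.mul hg).congr' EventuallyEq.rfl ?_).trans (isBigO_rpow_of_le h)
  filter_upwards [eventually_lt_norm 0] with x hx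
  rw [Real.rpow_add hx]

theorem isBigO_prod_rpow {κ : Type*} (S : Finset κ) {F : κ → Euc n → ℝ}
    (hF : ∀ i ∈ S, F i =O[cobounded (Euc n)] fun x => ‖x‖ ^ s) :
    (fun x => ∏ i ∈ S, F i x) =O[cobounded (Euc n)] fun x => ‖x‖ ^ (S.card * s) := by
  classical
  induction S using Finset.induction_on with
  | empty =>
    simp only [Finset.prod_empty, Finset.card_empty, Nat.cast_zero, zero_mul, Real.rpow_zero]
    exact isBigO_refl _ _
  | insert a S ha ih =>
    simp_rw [Finset.prod_insert ha]
    refine isBigO_mul_rpow (hF a (by simp)) (ih fun i hi => hF i (by simp [hi])) ?_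
    rw [Finset.card_insert_of_notMem ha]
    push_cast
    linarith

/-- Functions which are `O(r^s)` with first derivatives `O(r^{s-1})`. -/
structure IsSymbol (s : ℝ) (f : Euc n → ℝ) : Prop where
  diff : ∀ᶠ x in cobounded (Euc n), DifferentiableAt ℝ f x
  zero : f =O[cobounded (Euc n)] fun x => ‖x‖ ^ s
  one : ∀ p, pd p f =O[cobounded (Euc n)] fun x => ‖x‖ ^ (s - 1)

namespace IsSymbol

theorem mono (hf : IsSymbol s f) (h : s ≤ t) : IsSymbol t f where
  diff := hf.diff
  zero := hf.zero.trans (isBigO_rpow_of_le h)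
  one p := (hf.one p).trans (isBigO_rpow_of_le (by linarith))

theorem const (c : ℝ) : IsSymbol 0 (fun _ : Euc n => c) where
  diff := Eventually.of_forall fun x => differentiableAt_const c
  zero := by simpa using isBigO_const_const c (one_ne_zero (α := ℝ)) (cobounded (Euc n))
  one p := by
    have : pd p (fun _ : Euc n => c) = fun _ => 0 := by
      funext x
      simp [pd]
    rw [this]
    exact isBigO_zero _ _

theorem zero' (s : ℝ) : IsSymbol s (fun _ : Euc n => 0) where
  diff := Eventually.of_forall fun x => differentiableAt_const 0
  zero := isBigO_zero _ _
  one p := by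
    have : pd p (fun _ : Euc n => (0:ℝ)) = fun _ => 0 := by
      funext x
      simp [pd]
    rw [this]
    exact isBigO_zero _ _

theorem congr (hf : IsSymbol s f) (h : f =ᶠ[cobounded (Euc n)] g) : IsSymbol s g := by
  have h' := eventually_eventually_nhds_cobounded h
  refine ⟨?_, hf.zero.congr' h EventuallyEq.rfl, fun p => (hf.one p).congr' ?_ EventuallyEq.rfl⟩
  · filter_upwards [hf.diff, h'] with x hx hx'
    exact hx.congr_of_eventuallyEq (EventuallyEq.symm hx')
  · filter_upwards [h'] with x hx'
    rw [pd, pd, EventuallyEq.fderiv_eq hx']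

theorem add (hf : IsSymbol s f) (hg : IsSymbol s g) : IsSymbol s (fun x => f x + g x) where
  diff := by
    filter_upwards [hf.diff, hg.diff] with x h1 h2 using h1.add h2
  zero := hf.zero.add hg.zero
  one p := by
    refine ((hf.one p).add (hg.one p)).congr' ?_ EventuallyEq.rfl
    filter_upwards [hf.diff, hg.diff] with x h1 h2
    simp [pd, fderiv_fun_add h1 h2]

theorem mul (hf : IsSymbol s f) (hg : IsSymbol t g) : IsSymbol (s + t) (fun x => f x * g x) where
  diff := by
    filter_upwards [hf.diff, hg.diff] with x h1 h2 using h1.mul h2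
  zero := isBigO_mul_rpow hf.zero hg.zero le_rfl
  one p := by
    have h3 := (isBigO_mul_rpow hf.zero (hg.one p) (u := s + t - 1) (by linarith)).add
      (isBigO_mul_rpow (hf.one p) hg.zero (u := s + t - 1) (by linarith))
    refine h3.congr' ?_ EventuallyEq.rfl
    filter_upwards [hf.diff, hg.diff] with x h1 h2
    simp [pd, fderiv_fun_mul h1 h2]
    ring

theorem const_mul (c : ℝ) (hf : IsSymbol s f) : IsSymbol s (fun x => c * f x) := by
  simpa using (const c).mul hf

theorem neg (hf : IsSymbol s f) : IsSymbol s (fun x => -f x) := by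
  simpa using hf.const_mul (-1)

theorem sub (hf : IsSymbol s f) (hg : IsSymbol s g) : IsSymbol s (fun x => f x - g x) := by
  simpa [sub_eq_add_neg] using hf.add hg.neg

theorem sum {κ : Type*} {S : Finset κ} {F : κ → Euc n → ℝ} (hF : ∀ i ∈ S, IsSymbol s (F i)) :
    IsSymbol s (fun x => ∑ i ∈ S, F i x) := by
  classical
  induction S using Finset.induction_on with
  | empty => simpa using zero' s
  | insert a S ha ih =>
    simp_rw [Finset.sum_insert ha]
    exact (hF a (by simp)).add (ih fun i hi => hF i (by simp [hi]))

theorem tendsto {τ : ℝ} (hτ : 0 < τ) (hf : IsSymbol (-τ) f) :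
    Tendsto f (cobounded (Euc n)) (𝓝 0) :=
  hf.zero.trans_tendsto ((tendsto_rpow_neg_atTop hτ).comp tendsto_norm_cobounded_atTop)

/-- Since f tends to c, only ψ near c matters: there ψ is Lipschitz and its derivative is bounded,
so the chain rule gives both estimates. It serves for y⁻¹ and 1/√y at c = 1. -/
theorem comp_sub {τ c : ℝ} (hτ : 0 < τ) (hf : IsSymbol (-τ) fun x => f x - c) {ψ : ℝ → ℝ}
    (hψ : ContDiffAt ℝ 1 ψ c) : IsSymbol (-τ) (fun x => ψ (f x) - ψ c) := by
  have hlim : Tendsto f (cobounded (Euc n)) (𝓝 c) := by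
    simpa using (hf.tendsto hτ).add_const c
  have hfd : ∀ᶠ x in cobounded (Euc n), DifferentiableAt ℝ f x := by
    filter_upwards [hf.diff] with x hx
    simpa using hx.add_const c
  have hψd : ∀ᶠ y in 𝓝 c, DifferentiableAt ℝ ψ y := by
    filter_upwards [hψ.eventually (by simp)] with y hy
    exact hy.differentiableAt (by simp)
  have hψd' := hlim.eventually hψd
  refine ⟨?_, ?_, fun p => ?_⟩
  · filter_upwards [hfd, hψd'] with x h1 h2
    exact (h2.comp x h1).sub_const _
  · exact ((hψ.differentiableAt (by simp)).hasDerivAt.isBigO_sub.comp_tendsto hlim).trans hf.zero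
  · have hb : (fun x => deriv ψ (f x)) =O[cobounded (Euc n)] fun x => ‖x‖ ^ (0 : ℝ) := by
      have : ContinuousAt (deriv ψ) c :=
        (ContDiffAt.derivWithin hψ (m := 0) (by simp)).continuousAt
      simpa using (this.tendsto.comp hlim).isBigO_one ℝ
    refine (isBigO_mul_rpow hb (hf.one p) (u := -τ - 1) (by linarith)).congr' ?_ EventuallyEq.rfl
    filter_upwards [hfd, hψd'] with x h1 h2
    have h3 := (h2.hasDerivAt.comp_hasFDerivAt x h1.hasFDerivAt).sub_const (ψ c)
    have h4 : fderiv ℝ (fun x => f x - c) x = fderiv ℝ f x :=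
      (h1.hasFDerivAt.sub_const c).fderiv
    have e : fderiv ℝ (fun x => ψ (f x) - ψ c) x = deriv ψ (f x) • fderiv ℝ f x := h3.fderiv
    simp [pd, e, h4]

end IsSymbol

theorem hasFDerivAt_norm {x : Euc n} (hx : x ≠ 0) :
    HasFDerivAt (fun y : Euc n => ‖y‖) (‖x‖⁻¹ • innerSL ℝ x) x := by
  have h1 := (hasStrictFDerivAt_norm_sq x).hasFDerivAt.sqrt
    (by simpa using hx)
  have h0 : ‖x‖ ≠ 0 := norm_ne_zero_iff.mpr hx
  have e1 : (fun y : Euc n => Real.sqrt (‖y‖ ^ 2)) = fun y => ‖y‖ := by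
    funext y
    exact Real.sqrt_sq (norm_nonneg y)
  rw [e1] at h1
  convert! h1 using 1
  rw [Real.sqrt_sq (norm_nonneg x)]
  ext v
  simp
  field_simp

theorem hasFDerivAt_coord_div_norm {x : Euc n} (hx : x ≠ 0) (i : Fin n) :
    HasFDerivAt (fun y : Euc n => y i / ‖y‖)
      (‖x‖⁻¹ • EuclideanSpace.proj i - (x i / ‖x‖ ^ 3) • innerSL ℝ x) x := by
  have h0 : ‖x‖ ≠ 0 := norm_ne_zero_iff.mpr hx
  have h1 : HasFDerivAt (fun y : Euc n => y i) (EuclideanSpace.proj i : Euc n →L[ℝ] ℝ) x :=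
    (EuclideanSpace.proj i : Euc n →L[ℝ] ℝ).hasFDerivAt
  have h2 := h1.mul ((hasDerivAt_inv h0).comp_hasFDerivAt x (hasFDerivAt_norm hx))
  refine (h2.congr_of_eventuallyEq (Eventually.of_forall fun y => ?_)).congr_fderiv ?_
  · simp [div_eq_mul_inv]
  · ext v
    simp
    field_simp
    ring

theorem pd_coord_div_norm {x : Euc n} (hx : x ≠ 0) (i p : Fin n) :
    pd p (fun y : Euc n => y i / ‖y‖) x
      = (if p = i then 1 else 0) / ‖x‖ - x i * x p / ‖x‖ ^ 3 := by
  rw [pd, (hasFDerivAt_coord_div_norm hx i).fderiv]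
  simp [stdVec, EuclideanSpace.inner_single_right, div_eq_inv_mul, eq_comm]
  ring

theorem isSymbol_coord_div_norm (i : Fin n) : IsSymbol 0 (fun y : Euc n => y i / ‖y‖) := by
  have hb : ∀ (x : Euc n) (j : Fin n), |x j| ≤ ‖x‖ := fun x j => by
    simpa using PiLp.norm_apply_le x j
  refine ⟨?_, ?_, fun p => ?_⟩
  · filter_upwards [eventually_lt_norm 0] with x hx
    exact (hasFDerivAt_coord_div_norm (norm_pos_iff.mp hx) i).differentiableAt
  · refine IsBigO.of_bound 1 (Eventually.of_forall fun x => ?_)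
    rw [Real.norm_eq_abs, abs_div, abs_norm]
    simpa using div_le_one_of_le₀ (hb x i) (norm_nonneg x)
  · refine IsBigO.of_bound 2 ?_
    filter_upwards [eventually_lt_norm 0] with x hx
    rw [pd_coord_div_norm (norm_pos_iff.mp hx), zero_sub, Real.rpow_neg_one, norm_inv, norm_norm]
    have h1 : ‖(if p = i then (1:ℝ) else 0) / ‖x‖‖ ≤ ‖x‖⁻¹ := by
      split_ifs <;> simp
    have h2 : ‖x i * x p / ‖x‖ ^ 3‖ ≤ ‖x‖⁻¹ := by
      rw [norm_div, norm_mul, Real.norm_eq_abs, Real.norm_eq_abs, norm_pow, norm_norm,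
        div_le_iff₀ (by positivity)]
      calc |x i| * |x p| ≤ ‖x‖ * ‖x‖ := by gcongr <;> exact hb x _
        _ = ‖x‖⁻¹ * ‖x‖ ^ 3 := by field_simp
    exact (norm_sub_le _ _).trans (by linarith)

end Symbols

/-! ### Decay of curvature, unit normal and shape operator -/

section Decay
open Asymptotics Bornology
variable {n : ℕ} {τ : ℝ} {G : Euc n → Matrix (Fin n) (Fin n) ℝ}

/-- Decay of a metric to the flat one, together with its first two derivatives. -/
structure IsDecaying (τ : ℝ) (G : Euc n → Matrix (Fin n) (Fin n) ℝ) : Prop where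
  pos : 0 < τ
  symm : ∀ x i j, G x i j = G x j i
  entry : ∀ i j, IsSymbol (-τ) fun x => G x i j - if i = j then 1 else 0
  deriv : ∀ p i j, IsSymbol (-τ - 1) (pd p fun x => G x i j)

theorem IsSymbol.of_sub_const {f : Euc n → ℝ} {c : ℝ} (hτ : 0 < τ)
    (h : IsSymbol (-τ) fun x => f x - c) : IsSymbol 0 f := by
  simpa using (h.mono (t := 0) (by linarith)).add (IsSymbol.const c)

/-- This is fg - cd = (f - c)g + c(g - d), with g of order 0. -/
theorem IsSymbol.mul_sub_const {f g : Euc n → ℝ} {c d : ℝ} (hτ : 0 < τ)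
    (hf : IsSymbol (-τ) fun x => f x - c) (hg : IsSymbol (-τ) fun x => g x - d) :
    IsSymbol (-τ) fun x => f x * g x - c * d := by
  have h1 := (hf.mul (hg.of_sub_const hτ)).add ((hg.const_mul c).mono (t := -τ + 0) (by simp))
  rw [add_zero] at h1
  convert h1 using 2
  ring

theorem IsSymbol.prod_sub_const {κ : Type*} (S : Finset κ) {f : κ → Euc n → ℝ} {c : κ → ℝ}
    (hτ : 0 < τ) (hf : ∀ i ∈ S, IsSymbol (-τ) fun x => f i x - c i) :
    IsSymbol (-τ) fun x => ∏ i ∈ S, f i x - ∏ i ∈ S, c i := by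
  classical
  induction S using Finset.induction_on with
  | empty => simpa using IsSymbol.zero' (-τ)
  | insert a S ha ih =>
    simp_rw [Finset.prod_insert ha]
    exact (hf a (by simp)).mul_sub_const hτ (ih fun i hi => hf i (by simp [hi]))

theorem IsSymbol.det_sub_const {r : ℕ} {A : Euc n → Matrix (Fin r) (Fin r) ℝ}
    {A₀ : Matrix (Fin r) (Fin r) ℝ} (hτ : 0 < τ)
    (hA : ∀ i j, IsSymbol (-τ) fun x => A x i j - A₀ i j) :
    IsSymbol (-τ) fun x => (A x).det - A₀.det := by
  simp_rw [Matrix.det_apply', ← Finset.sum_sub_distrib, ← mul_sub]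
  exact IsSymbol.sum fun σ _ =>
    (IsSymbol.prod_sub_const Finset.univ hτ fun i _ => hA (σ i) i).const_mul _

namespace IsDecaying

variable (hG : IsDecaying τ G)
include hG

theorem entry_zero (i j : Fin n) : IsSymbol 0 fun x => G x i j :=
  (hG.entry i j).of_sub_const hG.pos

theorem det : IsSymbol (-τ) fun x => (G x).det - 1 := by
  have := IsSymbol.det_sub_const (A₀ := 1) hG.pos
    (fun i j => by simpa [Matrix.one_apply] using hG.entry i j)
  simpa using this

/-- The inverse is the adjugate over the determinant, and adjugate entries are determinants of
matrices with one row replaced by a constant one. Both factors therefore differ from their flat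
values by symbols of order -τ. -/
theorem inv (i j : Fin n) : IsSymbol (-τ) fun x => (G x)⁻¹ i j - if i = j then 1 else 0 := by
  have h1 : IsSymbol (-τ) fun x => ((G x).det)⁻¹ - 1 := by
    have := hG.det.comp_sub hG.pos (ψ := fun y => y⁻¹) (contDiffAt_inv ℝ one_ne_zero)
    simpa using this
  have h2 : IsSymbol (-τ) fun x => (G x).adjugate i j - (1 : Matrix (Fin n) (Fin n) ℝ).adjugate i j := by
    simp_rw [Matrix.adjugate_apply]
    refine IsSymbol.det_sub_const hG.pos fun a b => ?_
    by_cases h : a = j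
    · simpa [Matrix.updateRow_apply, h] using IsSymbol.zero' (-τ)
    · simpa [Matrix.updateRow_apply, h, Matrix.one_apply] using hG.entry a b
  have h3 := h1.mul_sub_const hG.pos h2
  simpa [Matrix.inv_def, Matrix.one_apply] using h3

theorem inv_zero (i j : Fin n) : IsSymbol 0 fun x => (G x)⁻¹ i j :=
  (hG.inv i j).of_sub_const hG.pos

theorem christoffel (l i j : Fin n) : IsSymbol (-τ - 1) (christoffel G l i j) := by
  refine IsSymbol.const_mul _ (IsSymbol.sum fun p _ => ?_)
  have h := (hG.inv_zero l p).mul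
    (((hG.deriv i j p).add (hG.deriv j i p)).sub (hG.deriv p i j))
  rwa [zero_add] at h

/-- The derivatives of Γ give the stated order; the terms quadratic in Γ are O(r^{-2τ-2}), which is
smaller because τ > 0. -/
theorem riemannUp (p l i j : Fin n) :
    riemannUp G p l i j =O[cobounded (Euc n)] fun x => ‖x‖ ^ (-τ - 2) := by
  have hτ := hG.pos
  have e : -τ - 1 - 1 = -τ - 2 := by ring
  have h1 := (hG.christoffel p j l).one i
  have h2 := (hG.christoffel p i l).one j
  rw [e] at h1 h2
  refine (h1.sub h2).add (IsBigO.fun_sum fun q _ => ?_)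
  exact (isBigO_mul_rpow (hG.christoffel p i q).zero (hG.christoffel q j l).zero
    (by linarith)).sub (isBigO_mul_rpow (hG.christoffel p j q).zero (hG.christoffel q i l).zero
    (by linarith))

theorem riemann (i j k l : Fin n) :
    riemann G i j k l =O[cobounded (Euc n)] fun x => ‖x‖ ^ (-τ - 2) :=
  IsBigO.fun_sum fun p _ =>
    isBigO_mul_rpow (hG.entry_zero k p).zero (hG.riemannUp p l i j) (by linarith)

theorem riemannMixed (i j k l : Fin n) :
    riemannMixed G i j k l =O[cobounded (Euc n)] fun x => ‖x‖ ^ (-τ - 2) := by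
  refine IsBigO.fun_sum fun p _ => IsBigO.fun_sum fun q _ => ?_
  exact isBigO_mul_rpow ((hG.inv_zero k p).mul (hG.inv_zero l q)).zero (hG.riemann i j p q)
    (by linarith)

theorem lovelockMixed (k : ℕ) (i j : Fin n) :
    lovelockMixed k G i j =O[cobounded (Euc n)] fun x => ‖x‖ ^ ((k : ℝ) * (-τ - 2)) := by
  refine (IsBigO.fun_sum fun a _ => IsBigO.fun_sum fun b _ => ?_).const_mul_left _
  refine IsBigO.const_mul_left ?_ _
  have := isBigO_prod_rpow Finset.univ (s := -τ - 2)
    fun s (_ : s ∈ (Finset.univ : Finset (Fin k))) => hG.riemannMixed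
      (a (fstPos le_rfl s)) (a (sndPos le_rfl s)) (b (fstPos le_rfl s)) (b (sndPos le_rfl s))
  simpa using this

/-- The difference of values of the Lovelock curvature at nearby vectors. -/
theorem lovelockAt_sub (k : ℕ) {u v u' v' : Euc n → Euc n}
    (hu : ∀ i, IsSymbol (-τ) fun x => u x i - u' x i)
    (hv : ∀ i, IsSymbol (-τ) fun x => v x i - v' x i)
    (hu' : ∀ i, IsSymbol 0 fun x => u' x i) (hv' : ∀ i, IsSymbol 0 fun x => v' x i) :
    (fun x => lovelockAt k G x (u x) (v x) - lovelockAt k G x (u' x) (v' x))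
      =O[cobounded (Euc n)] fun x => ‖x‖ ^ ((k : ℝ) * (-τ - 2) - τ) := by
  have hτ := hG.pos
  simp only [lovelockAt, ← Finset.sum_sub_distrib]
  refine IsBigO.fun_sum fun i _ => IsBigO.fun_sum fun j _ => ?_
  have h1 : (fun x => ∑ p, G x i p * ChernMass.lovelockMixed k G p j x) =O[cobounded (Euc n)]
      fun x => ‖x‖ ^ ((k : ℝ) * (-τ - 2)) :=
    IsBigO.fun_sum fun p _ =>
      isBigO_mul_rpow (hG.entry_zero i p).zero (hG.lovelockMixed k p j) (by linarith)
  have hv0 : IsSymbol 0 fun x => v x j := by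
    simpa using ((hv j).mono (t := 0) (by linarith)).add (hv' j)
  -- uv - u'v' = (u - u')v + u'(v - v').
  have h2 : IsSymbol (-τ) fun x => u x i * v x j - u' x i * v' x j := by
    have h := ((hu i).mul hv0).add (((hu' i).mul (hv j)).mono (t := -τ + 0) (by simp))
    rw [add_zero] at h
    convert h using 2
    ring
  refine (isBigO_mul_rpow h1 h2.zero (u := (k : ℝ) * (-τ - 2) - τ) (by linarith)).congr_left
    fun x => ?_
  ring

omit hG in
theorem sum_sq_div_norm {x : Euc n} (hx : x ≠ 0) : ∑ i, (x i / ‖x‖) * (x i / ‖x‖) = 1 := by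
  have h := EuclideanSpace.real_norm_sq_eq x
  have h0 : ‖x‖ ^ 2 ≠ 0 := by simpa using hx
  have : ∀ i, (x i / ‖x‖) * (x i / ‖x‖) = x i ^ 2 / ‖x‖ ^ 2 := fun i => by
    rw [div_mul_div_comm]
    ring
  simp_rw [this]
  rw [← Finset.sum_div, ← h, div_self h0]

theorem norm_sq_grad : IsSymbol (-τ)
    fun x => (∑ p, ∑ q, (G x)⁻¹ p q * (x p / ‖x‖) * (x q / ‖x‖)) - 1 := by
  have h : IsSymbol (-τ) fun x : Euc n => ∑ p, ∑ q,
      ((G x)⁻¹ p q - if p = q then 1 else 0) * ((x p / ‖x‖) * (x q / ‖x‖)) := by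
    refine IsSymbol.sum fun p _ => IsSymbol.sum fun q _ => ?_
    simpa using (hG.inv p q).mul ((isSymbol_coord_div_norm p).mul (isSymbol_coord_div_norm q))
  refine h.congr ?_
  filter_upwards [eventually_lt_norm 0] with x hx
  refine Eq.trans ?_ (congrArg (fun z => _ - z) (sum_sq_div_norm (norm_pos_iff.mp hx)))
  rw [← Finset.sum_sub_distrib]
  refine Finset.sum_congr rfl fun p _ => ?_
  simp_rw [sub_mul, Finset.sum_sub_distrib]
  congr 1
  · exact Finset.sum_congr rfl fun q _ => by ring
  · simp

/-- Both ingredients of ν are flat up to order -τ: the vector g^{ij} x_j / r differs from x_i / r by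
(g^{ij} - δ^{ij}) x_j / r, and its length tends to 1 at the same rate by `norm_sq_grad`. -/
theorem unitNormal_sub (i : Fin n) :
    IsSymbol (-τ) fun x => unitNormal G x i - x i / ‖x‖ := by
  have h1 : IsSymbol (-τ) fun x =>
      (Real.sqrt (∑ p, ∑ q, (G x)⁻¹ p q * (x p / ‖x‖) * (x q / ‖x‖)))⁻¹ - 1 := by
    have := hG.norm_sq_grad.comp_sub hG.pos (ψ := fun y => (Real.sqrt y)⁻¹)
      ((Real.contDiffAt_sqrt one_ne_zero).inv (by simp))
    simpa using this
  have h2 : IsSymbol (-τ) fun x : Euc n =>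
      ∑ j, ((G x)⁻¹ i j - if i = j then 1 else 0) * (x j / ‖x‖) :=
    IsSymbol.sum fun j _ => by simpa using (hG.inv i j).mul (isSymbol_coord_div_norm j)
  have h3 := (h2.mul (h1.of_sub_const hG.pos)).add ((isSymbol_coord_div_norm i).mul h1 |>.mono
    (t := -τ + 0) (by simp))
  rw [add_zero] at h3
  convert h3 using 2 with x
  simp only [unitNormal, sub_mul, Finset.sum_sub_distrib, ite_mul, one_mul, zero_mul,
    Finset.sum_ite_eq, Finset.mem_univ, if_true]
  ring

theorem unitNormal_zero (i : Fin n) : IsSymbol 0 fun x => unitNormal G x i := by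
  simpa using ((hG.unitNormal_sub i).mono (t := 0) (by linarith [hG.pos])).add
    (isSymbol_coord_div_norm i)

omit hG in
theorem radial_apply (x : Euc n) (i : Fin n) : radial x i = x i / ‖x‖ := by
  simp [radial, div_eq_inv_mul]

omit hG in
theorem radial_symbol (i : Fin n) : IsSymbol 0 fun x : Euc n => radial x i := by
  simpa only [radial_apply] using isSymbol_coord_div_norm i

theorem unitNormal_sub_radial (i : Fin n) :
    IsSymbol (-τ) fun x => unitNormal G x i - radial x i := by
  simpa only [radial_apply] using hG.unitNormal_sub i

end IsDecaying

/-- The deviation of the shape operator of the coordinate spheres from the Euclidean one. -/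
noncomputable def shapeError (G : Euc n → Matrix (Fin n) (Fin n) ℝ) (l p : Fin n) (x : Euc n) : ℝ :=
  pd p (fun y => unitNormal G y l - y l / ‖y‖) x + ∑ j, christoffel G l p j x * unitNormal G x j

namespace IsDecaying

variable (hG : IsDecaying τ G)
include hG

theorem shapeError (l p : Fin n) :
    shapeError G l p =O[cobounded (Euc n)] fun x => ‖x‖ ^ (-τ - 1) :=
  ((hG.unitNormal_sub l).one p).add (IsBigO.fun_sum fun j _ =>
    isBigO_mul_rpow (hG.christoffel l p j).zero (hG.unitNormal_zero j).zero (by linarith))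

/-- The derivative of x_l / r along X is X_l / r - x_l ⟨x, X⟩ / r³, and tangency removes the second
term. Everything else in ∇_X ν is collected in `shapeError`, so the identity is exact. -/
theorem connectionMap_unitNormal : ∀ᶠ x in cobounded (Euc n), ∀ X : Euc n, inner ℝ x X = 0 →
    ∀ l, connectionMap G x (unitNormal G x) (X, fderiv ℝ (unitNormal G) x X) l
      = ‖x‖⁻¹ * X l + ∑ p, ChernMass.shapeError G l p x * X p := by
  have hd : ∀ᶠ x in cobounded (Euc n), ∀ l,
      DifferentiableAt ℝ (fun y => unitNormal G y l - y l / ‖y‖) x :=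
    eventually_all.mpr fun l => (hG.unitNormal_sub l).diff
  filter_upwards [hd, eventually_lt_norm 0] with x hx hx0 X hX l
  have hx0 := norm_pos_iff.mp hx0
  have hcomp : ∀ l, HasFDerivAt (fun y => unitNormal G y l)
      (fderiv ℝ (fun y => unitNormal G y l - y l / ‖y‖) x +
        (‖x‖⁻¹ • EuclideanSpace.proj l - (x l / ‖x‖ ^ 3) • innerSL ℝ x)) x := fun l =>
    ((hx l).hasFDerivAt.add (hasFDerivAt_coord_div_norm hx0 l)).congr_of_eventuallyEq
      (Eventually.of_forall fun y => by simp)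
  have hdiff : DifferentiableAt ℝ (unitNormal G) x :=
    differentiableAt_euclidean.mpr fun l => (hcomp l).differentiableAt
  have h1 : fderiv ℝ (unitNormal G) x X l =
      fderiv ℝ (fun y => unitNormal G y l - y l / ‖y‖) x X + ‖x‖⁻¹ * X l := by
    -- The component of the derivative of ν is compared with the derivative of the component by
    -- uniqueness of Fréchet derivatives.
    have h2 := (EuclideanSpace.proj l : Euc n →L[ℝ] ℝ).hasFDerivAt.comp x hdiff.hasFDerivAt
    have h3 := congrArg (fun L => L X) (h2.unique (hcomp l))
    simp only [ContinuousLinearMap.comp_apply, add_apply,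
      sub_apply, smul_apply, innerSL_apply_apply, hX] at h3
    simpa using h3
  have h4 : fderiv ℝ (fun y => unitNormal G y l - y l / ‖y‖) x X
      = ∑ p, pd p (fun y => unitNormal G y l - y l / ‖y‖) x * X p := by
    have hX' : X = ∑ p, X p • stdVec p := by
      ext i
      simp [stdVec, Finset.sum_apply, Pi.single_apply]
    conv_lhs => rw [hX']
    rw [map_sum]
    refine Finset.sum_congr rfl fun p _ => ?_
    rw [map_smul, smul_eq_mul, mul_comm]
    rfl
  simp only [connectionMap, h1, h4, ChernMass.shapeError, add_mul, Finset.sum_add_distrib, Finset.sum_mul]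
  have h5 : ∀ p j, ChernMass.christoffel G l p j x * X p * unitNormal G x j
      = ChernMass.christoffel G l p j x * unitNormal G x j * X p := fun p j => by ring
  simp_rw [h5]
  ring

/-- Vectors tangent to the coordinate spheres are orthogonal to the unit normal. -/
theorem metricAt_unitNormal : ∀ᶠ x in cobounded (Euc n), ∀ X : Euc n, inner ℝ x X = 0 →
    metricAt G x (unitNormal G x) X = 0 := by
  have hdet : ∀ᶠ x in cobounded (Euc n), (G x).det ≠ 0 := by
    have h := hG.det.tendsto hG.pos
    -- The value -1 of det g - 1 corresponds to a degenerate metric.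
    filter_upwards [h.eventually (eventually_ne_nhds (a := (0:ℝ)) (b := -1) (by norm_num))] with x hx h0
    simp [h0] at hx
  filter_upwards [hdet] with x hx X hX
  have hmul : (G x) * (G x)⁻¹ = 1 := Matrix.mul_nonsing_inv _ (isUnit_iff_ne_zero.mpr hx)
  set w := Real.sqrt (∑ p, ∑ q, (G x)⁻¹ p q * (x p / ‖x‖) * (x q / ‖x‖)) with hw
  -- Lowering the index of ν recovers dr up to the factor 1/w, and dr annihilates tangent vectors.
  have h1 : ∀ j, ∑ i, G x i j * unitNormal G x i = x j / ‖x‖ / w := by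
    intro j
    calc ∑ i, G x i j * unitNormal G x i
        = ∑ i, ∑ p, G x j i * (G x)⁻¹ i p * (x p / ‖x‖ / w) := by
          refine Finset.sum_congr rfl fun i _ => ?_
          simp only [unitNormal, ← hw]
          rw [hG.symm x i j, Finset.sum_div, Finset.mul_sum]
          exact Finset.sum_congr rfl fun p _ => by ring
      _ = ∑ p, (G x * (G x)⁻¹) j p * (x p / ‖x‖ / w) := by
          rw [Finset.sum_comm]
          refine Finset.sum_congr rfl fun p _ => ?_
          rw [Matrix.mul_apply, Finset.sum_mul]
      _ = x j / ‖x‖ / w := by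
          rw [hmul]
          simp [Matrix.one_apply]
  rw [metricAt, Finset.sum_comm]
  simp_rw [← Finset.sum_mul, h1]
  have h2 : ∑ j, x j * X j = 0 := by
    rw [← hX, PiLp.inner_apply]
    refine Finset.sum_congr rfl fun j _ => ?_
    simp [mul_comm]
  have h3 : ∀ j, x j / ‖x‖ / w * X j = (x j * X j) * (‖x‖⁻¹ * w⁻¹) := fun j => by
    rw [div_eq_mul_inv, div_eq_mul_inv]
    ring
  simp_rw [h3]
  rw [← Finset.sum_mul, h2, zero_mul]

end IsDecaying
end Decay

/-! ### Determinants under rank-one perturbation -/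

section RankOne

/-- The matrix determinant lemma, without invertibility. -/
theorem det_sub_vecMulVec {r : ℕ} (A : Matrix (Fin r) (Fin r) ℝ) (u v : Fin r → ℝ) :
    (A - Matrix.vecMulVec u v).det = A.det - ∑ s, ∑ t, v t * A.adjugate t s * u s := by
  have hinv : ∀ B : Matrix (Fin r) (Fin r) ℝ, B.det ≠ 0 →
      (B - Matrix.vecMulVec u v).det = B.det - ∑ s, ∑ t, v t * B.adjugate t s * u s := by
    intro B hB
    have h := Matrix.det_add_replicateCol_mul_replicateRow (ι := Unit) (A := B)
      (isUnit_iff_ne_zero.mpr hB) (-u) v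
    have e1 : B + Matrix.replicateCol Unit (-u) * Matrix.replicateRow Unit v
        = B - Matrix.vecMulVec u v := by
      ext i j
      simp [Matrix.mul_apply, Matrix.vecMulVec_apply, sub_eq_add_neg]
    rw [← e1, h, Matrix.det_unique (n := Unit), Matrix.inv_def]
    simp only [Matrix.add_apply, Matrix.one_apply_eq, Matrix.mul_apply, Matrix.replicateRow_apply,
      Matrix.smul_apply, Matrix.replicateCol_apply, Ring.inverse_eq_inv', smul_eq_mul, Pi.neg_apply]
    rw [mul_add, mul_one, sub_eq_add_neg, Finset.mul_sum, ← Finset.sum_neg_distrib]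
    congr 1
    refine Finset.sum_congr rfl fun s _ => ?_
    rw [Finset.sum_mul, Finset.mul_sum, ← Finset.sum_neg_distrib]
    refine Finset.sum_congr rfl fun t _ => ?_
    field_simp
  -- A + tI is singular only at the finitely many roots of the characteristic polynomial of -A, so
  -- the invertible case applies for small t ≠ 0 and the identity extends to t = 0 by continuity.
  have hcont : ∀ᶠ t : ℝ in 𝓝[≠] 0, (A + t • (1 : Matrix (Fin r) (Fin r) ℝ)).det ≠ 0 := by
    have hfin : {t : ℝ | (-A).charpoly.IsRoot t}.Finite :=
      Polynomial.finite_setOfPred_isRoot (Matrix.charpoly_monic _).ne_zero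
    have hmem : ({t : ℝ | (-A).charpoly.IsRoot t} \ {0})ᶜ ∈ 𝓝 (0 : ℝ) :=
      (hfin.subset Set.sdiff_subset).isClosed.isOpen_compl.mem_nhds (by simp)
    filter_upwards [nhdsWithin_le_nhds hmem, self_mem_nhdsWithin] with t ht ht0 hdet
    refine ht ⟨?_, ht0⟩
    simp only [Set.mem_ofPred_eq, Polynomial.IsRoot, Matrix.eval_charpoly]
    rw [← hdet]
    congr 1
    ext i j
    simp [Matrix.scalar_apply, Matrix.one_apply, Matrix.diagonal_apply, add_comm]
  have hA : Continuous fun t : ℝ => A + t • (1 : Matrix (Fin r) (Fin r) ℝ) := by fun_prop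
  have hL : Continuous fun t : ℝ =>
      (A + t • (1 : Matrix (Fin r) (Fin r) ℝ) - Matrix.vecMulVec u v).det :=
    (hA.sub continuous_const).matrix_det
  have hR : Continuous fun t : ℝ => (A + t • (1 : Matrix (Fin r) (Fin r) ℝ)).det
      - ∑ s, ∑ i, v i * (A + t • (1 : Matrix (Fin r) (Fin r) ℝ)).adjugate i s * u s := by
    refine hA.matrix_det.sub (continuous_finsetSum _ fun s _ => continuous_finsetSum _ fun i _ => ?_)
    exact (continuous_const.mul (hA.matrix_adjugate.matrix_elem i s)).mul continuous_const
  have l1 := (hL.tendsto 0).mono_left (nhdsWithin_le_nhds (s := {0}ᶜ))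
  have l2 := (hR.tendsto 0).mono_left (nhdsWithin_le_nhds (s := {0}ᶜ))
  have l3 := l1.congr' (by filter_upwards [hcont] with t ht using hinv _ ht)
  simpa using tendsto_nhds_unique l3 l2

end RankOne

/-! ### Algebra of the generalized Kronecker delta -/

section GenDelta
variable {ι : Type*} [Fintype ι] [DecidableEq ι]

/-- Appending c borders the delta matrix A by a row, a column and a corner entry 1. The Schur
complement of the corner is a rank-one perturbation of A, so the determinant is det A minus a
correction. Summed over c, the first term occurs once for each element of `ι`, and the correction
becomes the trace of A · adj A, which is r det A. -/
theorem sum_genDelta_snoc {r : ℕ} (a b : Fin r → ι) :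
    ∑ c, genDelta (Fin.snoc a c : Fin (r + 1) → ι) (Fin.snoc b c : Fin (r + 1) → ι)
      = ((Fintype.card ι : ℝ) - r) * genDelta a b := by
  set A : Matrix (Fin r) (Fin r) ℝ := Matrix.of fun s t => if b s = a t then (1 : ℝ) else 0 with hA
  have key : ∀ c, genDelta (Fin.snoc a c : Fin (r + 1) → ι) (Fin.snoc b c : Fin (r + 1) → ι)
      = A.det - ∑ s, ∑ t, (if a t = c then (1:ℝ) else 0) * A.adjugate t s
          * (if b s = c then 1 else 0) := by
    intro c
    rw [← det_sub_vecMulVec, genDelta,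
      ← Matrix.det_submatrix_equiv_self (finSumFinEquiv (m := r) (n := 1))]
    have : (Matrix.of fun s t : Fin (r + 1) =>
        if (Fin.snoc b c : Fin (r + 1) → ι) s = (Fin.snoc a c : Fin (r + 1) → ι) t
        then (1 : ℝ) else 0).submatrix (finSumFinEquiv (m := r) (n := 1)) finSumFinEquiv
        = Matrix.fromBlocks A (Matrix.of fun s (_ : Fin 1) => if b s = c then (1:ℝ) else 0)
          (Matrix.of fun (_ : Fin 1) t => if a t = c then (1:ℝ) else 0) 1 := by
      have hl : ∀ (d : Fin r → ι) (i : Fin r),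
          (Fin.snoc d c : Fin (r + 1) → ι) (Fin.castAdd 1 i) = d i :=
        fun d i => Fin.snoc_castSucc (α := fun _ => ι) (i := i) ..
      have hr : ∀ (d : Fin r → ι) (i : Fin 1),
          (Fin.snoc d c : Fin (r + 1) → ι) (Fin.natAdd r i) = c := by
        intro d i
        have : Fin.natAdd r i = Fin.last r := by ext; simp
        rw [this]
        simp
      ext (i | i) (j | j)
      · simp [hl, hA]
      · simp [hl, hr]
      · simp [hl, hr, eq_comm]
      · simp [hr, Subsingleton.elim i j]
    rw [this, Matrix.det_fromBlocks_one₂₂]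
    congr 1
    ext i j
    simp [Matrix.mul_apply, Matrix.vecMulVec_apply]
  simp_rw [key]
  rw [Finset.sum_sub_distrib, Finset.sum_const, Finset.card_univ, Finset.sum_comm]
  have h2 : ∀ s, ∑ c, ∑ t, (if a t = c then (1:ℝ) else 0) * A.adjugate t s
      * (if b s = c then 1 else 0) = A.det := by
    intro s
    rw [Finset.sum_comm]
    have : ∀ t, ∑ c, (if a t = c then (1:ℝ) else 0) * A.adjugate t s
      * (if b s = c then 1 else 0) = A s t * A.adjugate t s := by
      intro t
      rw [Finset.sum_eq_single (a t)]
      · simp [hA, mul_comm]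
      · intro c _ hc
        simp [hc.symm]
      · simp
    rw [Finset.sum_congr rfl fun t _ => this t, ← Matrix.mul_apply, Matrix.mul_adjugate]
    simp
  rw [Finset.sum_congr rfl fun s _ => h2 s]
  simp [genDelta, hA, sub_mul]

theorem sum_genDelta_append {r q : ℕ} (a b : Fin r → ι) :
    ∑ t : Fin q → ι, genDelta (Fin.append a t) (Fin.append b t)
      = (∏ j ∈ Finset.range q, ((Fintype.card ι : ℝ) - r - j)) * genDelta a b := by
  induction q with
  | zero =>
    rw [Fintype.sum_subsingleton _ (Fin.elim0 : Fin 0 → ι)]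
    simp only [Finset.range_zero, Finset.prod_empty, one_mul]
    congr 1
    all_goals
    · ext i
      exact Fin.append_left _ _ i
  | succ q ih =>
    rw [← (Fin.snocEquiv (fun _ : Fin (q + 1) => ι)).sum_comp, Fintype.sum_prod_type,
      Finset.sum_comm, Finset.prod_range_succ, mul_right_comm, ← ih, Finset.sum_mul]
    refine Finset.sum_congr rfl fun t _ => ?_
    have h := sum_genDelta_snoc (Fin.append a t) (Fin.append b t)
    have e : ∀ (d : Fin r → ι) (c : ι),
        Fin.append d (Fin.snoc t c : Fin (q + 1) → ι)
          = (Fin.snoc (Fin.append d t) c : Fin (r + q + 1) → ι) := by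
      intro d c
      exact Fin.append_snoc d t c
    simp only [Fin.snocEquiv, Equiv.coe_fn_mk]
    simp_rw [e]
    refine h.trans ?_
    push_cast
    ring

/-- Each factor is a Levi-Civita symbol, the determinant of a matrix whose columns are selected
basis vectors; the claim is multiplicativity of det. -/
theorem genDelta_id_mul {N : ℕ} (a b : Fin N → Fin N) :
    genDelta a id * genDelta b id = genDelta a b := by
  rw [genDelta, genDelta, genDelta, ← Matrix.det_transpose (M := Matrix.of fun s t : Fin N =>
    if id s = b t then (1:ℝ) else 0), mul_comm, ← Matrix.det_mul]
  congr 1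
  ext s t
  simp [Matrix.mul_apply, eq_comm]

theorem det_submatrix_eq_genDelta {N : ℕ} (C : Matrix (Fin N) (Fin N) ℝ) (b : Fin N → Fin N) :
    (C.submatrix b id).det = genDelta b id * C.det := by
  rw [genDelta, ← Matrix.det_transpose, ← Matrix.det_transpose (M := Matrix.of fun s t : Fin N =>
    if id s = b t then (1:ℝ) else 0), ← Matrix.det_mul, ← Matrix.det_transpose]
  congr 1
  ext s t
  simp [Matrix.mul_apply]

/-- The generalized delta is an invariant tensor: its components are the same in every basis. In the
Leibniz expansion each permutation pairs the indices so that every sum over an `a t` is an entry of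
PQ = 1. -/
theorem sum_genDelta_mul_prod {r : ℕ} (P Q : Matrix ι ι ℝ) (hPQ : P * Q = 1)
    (α β : Fin r → ι) :
    ∑ a : Fin r → ι, ∑ b : Fin r → ι,
      genDelta a b * ((∏ t, P (α t) (a t)) * ∏ t, Q (b t) (β t)) = genDelta α β := by
  have h1 : genDelta α β = ∑ σ : Equiv.Perm (Fin r), ((Equiv.Perm.sign σ : ℤ) : ℝ) *
      ∑ a : Fin r → ι, ∏ t, P (α t) (a t) * Q (a t) (β (σ t)) := by
    rw [genDelta, Matrix.det_apply']
    refine Finset.sum_congr rfl fun σ _ => ?_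
    congr 1
    have := Finset.prod_univ_sum (fun _ : Fin r => (Finset.univ : Finset ι))
      (fun t c => P (α t) c * Q c (β (σ t)))
    rw [Fintype.piFinset_univ] at this
    rw [← this]
    refine Finset.prod_congr rfl fun t _ => ?_
    rw [← Matrix.mul_apply, hPQ, Matrix.one_apply]
    simp [eq_comm]
  rw [h1]
  simp_rw [genDelta, Matrix.det_apply', Finset.sum_mul]
  have h2 : ∀ a : Fin r → ι, ∑ b : Fin r → ι, ∑ σ : Equiv.Perm (Fin r),
      ((Equiv.Perm.sign σ : ℤ) : ℝ) *
        (∏ i, (Matrix.of fun s t : Fin r => if b s = a t then (1 : ℝ) else 0) (σ i) i) *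
        ((∏ t, P (α t) (a t)) * ∏ t, Q (b t) (β t))
      = ∑ σ : Equiv.Perm (Fin r), ((Equiv.Perm.sign σ : ℤ) : ℝ) *
        ∏ t, P (α t) (a t) * Q (a t) (β (σ t)) := by
    intro a
    rw [Finset.sum_comm]
    refine Finset.sum_congr rfl fun σ _ => ?_
    -- For fixed a and σ the product of Kronecker deltas forces b ∘ σ = a.
    rw [Finset.sum_eq_single (a ∘ σ.symm)]
    · have e1 : (∏ i, (Matrix.of fun s t : Fin r =>
          if (a ∘ σ.symm) s = a t then (1 : ℝ) else 0) (σ i) i) = 1 := by simp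
      rw [e1, mul_one, Finset.prod_mul_distrib, ← Equiv.prod_comp σ (fun t => Q ((a ∘ σ.symm) t) (β t))]
      simp
    · intro b _ hb
      have : ∃ i, b (σ i) ≠ a i := by
        by_contra! h
        exact hb (funext fun i => by simpa using h (σ.symm i))
      obtain ⟨i, hi⟩ := this
      rw [Finset.prod_eq_zero (Finset.mem_univ i) (by simp [hi])]
      simp
    · simp
  rw [Finset.sum_congr rfl fun a _ => h2 a, Finset.sum_comm]
  refine Finset.sum_congr rfl fun σ _ => ?_
  rw [Finset.mul_sum]

/-- The leading index differs from all tangential ones, so the first row has a single nonzero entry.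
This is how the normal index drops out of E(ν,ν). -/
theorem genDelta_cons_last_castSucc {m r : ℕ} (a b : Fin r → Fin m) :
    genDelta (Fin.cons (Fin.last m) (fun t => (a t).castSucc) : Fin (r + 1) → Fin (m + 1))
      (Fin.cons (Fin.last m) (fun t => (b t).castSucc) : Fin (r + 1) → Fin (m + 1))
      = genDelta a b := by
  rw [genDelta, Matrix.det_succ_row_zero, Fin.sum_univ_succ]
  have h0 : ∀ c : Fin m, Fin.last m ≠ c.castSucc := fun c => (Fin.castSucc_lt_last c).ne'
  simp [h0, genDelta, Matrix.submatrix]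

end GenDelta

theorem genDelta_eq_zero_left {ι : Type*} [DecidableEq ι] {r : ℕ} {a b : Fin r → ι} {s t : Fin r} (hst : s ≠ t)
    (h : a s = a t) : genDelta a b = 0 :=
  Matrix.det_zero_of_column_eq hst fun i => by simp [h]

theorem genDelta_eq_zero_right {ι : Type*} [DecidableEq ι] {r : ℕ} {a b : Fin r → ι} {s t : Fin r} (hst : s ≠ t)
    (h : b s = b t) : genDelta a b = 0 :=
  Matrix.det_zero_of_row_eq hst (by ext j; simp [h])

/-! ### Splitting index lists into pairs and tail -/

section Positions
variable {m k : ℕ} (hk : 2 * k ≤ m)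

/-- The positions `0, …, m - 1`, split into `k` pairs and the tail. -/
def posFun : (Fin k × Bool) ⊕ Fin (m - 2 * k) → Fin m
  | Sum.inl (s, false) => fstPos hk s
  | Sum.inl (s, true) => sndPos hk s
  | Sum.inr l => tailPos hk l

theorem posFun_bijective : Function.Bijective (posFun hk) := by
  rw [Fintype.bijective_iff_injective_and_card]
  constructor
  · rintro (⟨s, _ | _⟩ | l) (⟨s', _ | _⟩ | l') h <;>
      simp only [posFun, fstPos, sndPos, tailPos, Fin.mk.injEq] at h <;>
      first
      | (exfalso; have := s.2; have := s'.2; omega)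
      | (exfalso; have := s.2; omega)
      | (exfalso; have := s'.2; omega)
      | (have : s = s' := Fin.ext (by omega)
         rw [this])
      | (have : l = l' := Fin.ext (by omega)
         rw [this])
  · simp
    omega

theorem prod_positions {R : Type*} [CommMonoid R] (f : Fin m → R) :
    ∏ i, f i = (∏ s, f (fstPos hk s) * f (sndPos hk s)) * ∏ l, f (tailPos hk l) := by
  rw [← (posFun_bijective hk).prod_comp, Fintype.prod_sum_type, Fintype.prod_prod_type]
  congr 1
  refine Finset.prod_congr rfl fun s _ => ?_
  rw [Fintype.prod_bool, mul_comm]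
  rfl

theorem prod_pairs {R : Type*} [CommMonoid R] (f : Fin (2 * k) → R) :
    ∏ i, f i = ∏ s, f (fstPos le_rfl s) * f (sndPos le_rfl s) := by
  rw [prod_positions (le_refl (2 * k)) f]
  have : IsEmpty (Fin (2 * k - 2 * k)) := by simpa using Fin.isEmpty
  simp

theorem pairs_bijective (I : Type*) (k : ℕ) : Function.Bijective
    (fun (a : Fin (2 * k) → I) (s : Fin k) => (a (fstPos le_rfl s), a (sndPos le_rfl s))) := by
  constructor
  · intro a b h
    funext i
    obtain ⟨p, rfl⟩ := (posFun_bijective (le_refl (2 * k))).2 i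
    rcases p with ⟨s, _ | _⟩ | l
    · exact congrArg Prod.fst (congrFun h s)
    · exact congrArg Prod.snd (congrFun h s)
    · exact absurd l.2 (by omega)
  · intro p
    refine ⟨fun i => if (i : ℕ) % 2 = 0 then (p ⟨i / 2, by omega⟩).1
      else (p ⟨i / 2, by omega⟩).2, ?_⟩
    funext s
    have h1 : (2 * (s : ℕ) + 1) % 2 = 1 := by omega
    have h2 : (2 * (s : ℕ) + 1) / 2 = s := by omega
    simp [fstPos, sndPos, h1, h2]

/-- Distributivity, with a choice of k pairs encoded as one list of length 2k, the form in which the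
deltas take their indices. -/
theorem prod_sum_pairs {I R : Type*} [Fintype I] [CommSemiring R] (g : Fin k → I → I → R) :
    ∏ s, ∑ γ, ∑ δ, g s γ δ
      = ∑ b : Fin (2 * k) → I, ∏ s, g s (b (fstPos le_rfl s)) (b (sndPos le_rfl s)) := by
  classical
  have h := Finset.prod_univ_sum (fun _ : Fin k => (Finset.univ : Finset (I × I)))
    (fun s p => g s p.1 p.2)
  rw [Fintype.piFinset_univ] at h
  rw [← (pairs_bijective I k).sum_comp (fun p : Fin k → I × I => ∏ s, g s (p s).1 (p s).2)] at h
  rw [← h]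
  refine Finset.prod_congr rfl fun s _ => ?_
  rw [Fintype.sum_prod_type]

/-- The list `a_1, …, a_{2k}, t_1, …, t_{m-2k}`. -/
def combine {I : Type*} (a : Fin (2 * k) → I) (t : Fin (m - 2 * k) → I) : Fin m → I :=
  fun i => Fin.append a t (Fin.cast (by omega) i)

theorem combine_fstPos {I : Type*} (a : Fin (2 * k) → I) (t : Fin (m - 2 * k) → I) (s : Fin k) :
    combine hk a t (fstPos hk s) = a (fstPos le_rfl s) :=
  Fin.append_left a t (fstPos le_rfl s)

theorem combine_sndPos {I : Type*} (a : Fin (2 * k) → I) (t : Fin (m - 2 * k) → I) (s : Fin k) :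
    combine hk a t (sndPos hk s) = a (sndPos le_rfl s) :=
  Fin.append_left a t (sndPos le_rfl s)

theorem combine_tailPos {I : Type*} (a : Fin (2 * k) → I) (t : Fin (m - 2 * k) → I)
    (l : Fin (m - 2 * k)) : combine hk a t (tailPos hk l) = t l :=
  Fin.append_right a t l

theorem combine_bijective (I : Type*) : Function.Bijective
    (fun p : (Fin (2 * k) → I) × (Fin (m - 2 * k) → I) => combine hk p.1 p.2) := by
  constructor
  · rintro ⟨a, t⟩ ⟨b, u⟩ h
    have h1 : a = b := (pairs_bijective I k).1 (funext fun s => Prod.ext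
      (by have := congrFun h (fstPos hk s); simpa [combine_fstPos] using this)
      (by have := congrFun h (sndPos hk s); simpa [combine_sndPos] using this))
    have h2 : t = u := funext fun l => by
      have := congrFun h (tailPos hk l)
      simpa [combine_tailPos] using this
    rw [h1, h2]
  · intro c
    obtain ⟨a, ha⟩ := (pairs_bijective I k).2 fun s => (c (fstPos hk s), c (sndPos hk s))
    refine ⟨(a, fun l => c (tailPos hk l)), ?_⟩
    funext i
    obtain ⟨p, rfl⟩ := (posFun_bijective hk).2 i
    rcases p with ⟨s, _ | _⟩ | l
    · exact (combine_fstPos hk _ _ s).trans (congrArg Prod.fst (congrFun ha s))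
    · exact (combine_sndPos hk _ _ s).trans (congrArg Prod.snd (congrFun ha s))
    · exact combine_tailPos hk _ _ l

theorem genDelta_combine {I : Type*} [DecidableEq I] (a b : Fin (2 * k) → I)
    (t u : Fin (m - 2 * k) → I) :
    genDelta (combine hk a t) (combine hk b u) = genDelta (Fin.append a t) (Fin.append b u) := by
  rw [genDelta, genDelta, ← Matrix.det_submatrix_equiv_self
    (finCongr (show m = 2 * k + (m - 2 * k) by omega))]
  rfl

/-- In dimension m, contracting m - 2k indices beyond the first 2k gives the factors m - 2k - j,
whose product is the factorial. -/
theorem sum_genDelta_combine (a b : Fin (2 * k) → Fin m) :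
    ∑ t, genDelta (combine hk a t) (combine hk b t)
      = ((m - 2 * k).factorial : ℝ) * genDelta a b := by
  simp_rw [genDelta_combine]
  rw [sum_genDelta_append]
  congr 1
  have : ∀ q : ℕ, ∏ j ∈ Finset.range q, ((q : ℝ) - j) = (q.factorial : ℝ) := by
    intro q
    rw [← Finset.prod_range_add_one_eq_factorial, ← Finset.prod_range_reflect]
    push_cast
    refine Finset.prod_congr rfl fun j hj => ?_
    have hj := Finset.mem_range.mp hj
    rw [Nat.sub_sub, Nat.cast_sub (by omega)]
    push_cast
    ring
  rw [← this]
  refine Finset.prod_congr rfl fun j _ => ?_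
  rw [Nat.cast_sub hk]
  simp

end Positions

/-! ### Wedge products contracted with the permutation symbol -/

section Wedge
variable {m k : ℕ} (hk : 2 * k ≤ m)

/-- Antisymmetrizing the two-forms in a wedge product contributes a factor `2` for each of them. -/
theorem wedge_antisymm {V : Type*} (B : Fin k → V → V → ℝ) (θ : Fin (m - 2 * k) → V → ℝ)
    (X : Fin m → V) :
    wedge hk (fun s u v => B s u v - B s v u) θ X = 2 ^ k * wedge hk B θ X := by
  -- Induction over the set S of two-forms that have already been antisymmetrized.
  have key : ∀ S : Finset (Fin k),
      ∑ π : Equiv.Perm (Fin m), ((Equiv.Perm.sign π : ℤ) : ℝ) *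
        ((∏ s, (B s (X (π (fstPos hk s))) (X (π (sndPos hk s))) - if s ∈ S then
          B s (X (π (sndPos hk s))) (X (π (fstPos hk s))) else 0)) *
          ∏ l, θ l (X (π (tailPos hk l))))
      = 2 ^ S.card * ∑ π : Equiv.Perm (Fin m), ((Equiv.Perm.sign π : ℤ) : ℝ) *
        ((∏ s, B s (X (π (fstPos hk s))) (X (π (sndPos hk s)))) *
          ∏ l, θ l (X (π (tailPos hk l)))) := by
    intro S
    induction S using Finset.induction_on with
    | empty => simp
    | insert s₀ S hs ih =>
      rw [Finset.card_insert_of_notMem hs, pow_succ', mul_assoc, ← ih]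
      set D : Fin k → Equiv.Perm (Fin m) → ℝ := fun s π =>
        B s (X (π (fstPos hk s))) (X (π (sndPos hk s))) - if s ∈ S then
          B s (X (π (sndPos hk s))) (X (π (fstPos hk s))) else 0 with hD
      set T : Equiv.Perm (Fin m) → ℝ := fun π => ∏ l, θ l (X (π (tailPos hk l))) with hT
      set U : Equiv.Perm (Fin m) → ℝ := fun π => ∏ s ∈ Finset.univ.erase s₀, D s π with hU
      have hsplit : ∀ π : Equiv.Perm (Fin m),
          (∏ s, (B s (X (π (fstPos hk s))) (X (π (sndPos hk s))) - if s ∈ insert s₀ S then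
            B s (X (π (sndPos hk s))) (X (π (fstPos hk s))) else 0))
          = (B s₀ (X (π (fstPos hk s₀))) (X (π (sndPos hk s₀)))
            - B s₀ (X (π (sndPos hk s₀))) (X (π (fstPos hk s₀)))) * U π := by
        intro π
        rw [← Finset.mul_prod_erase _ _ (Finset.mem_univ s₀)]
        congr 1
        · simp
        · refine Finset.prod_congr rfl fun s hs' => ?_
          have : s ≠ s₀ := Finset.ne_of_mem_erase hs'
          simp [hD, this]
      have hsplit' : ∀ π : Equiv.Perm (Fin m), ∏ s, D s π
          = B s₀ (X (π (fstPos hk s₀))) (X (π (sndPos hk s₀))) * U π := by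
        intro π
        rw [← Finset.mul_prod_erase _ _ (Finset.mem_univ s₀)]
        simp [hD, hs, hU]
      -- Precomposing π with the transposition of the two slots of the form s₀ changes the sign and
      -- leaves all other factors untouched.
      have hswap : ∑ π : Equiv.Perm (Fin m), ((Equiv.Perm.sign π : ℤ) : ℝ) *
          (B s₀ (X (π (sndPos hk s₀))) (X (π (fstPos hk s₀))) * U π * T π)
          = - ∑ π : Equiv.Perm (Fin m), ((Equiv.Perm.sign π : ℤ) : ℝ) *
          (B s₀ (X (π (fstPos hk s₀))) (X (π (sndPos hk s₀))) * U π * T π) := by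
        have hne : fstPos hk s₀ ≠ sndPos hk s₀ := by
          simp [fstPos, sndPos]
        rw [← Equiv.sum_comp (Equiv.mulRight (Equiv.swap (fstPos hk s₀) (sndPos hk s₀))),
          ← Finset.sum_neg_distrib]
        refine Finset.sum_congr rfl fun π _ => ?_
        have hfix : ∀ i : Fin m, i ≠ fstPos hk s₀ → i ≠ sndPos hk s₀ →
            (π * Equiv.swap (fstPos hk s₀) (sndPos hk s₀)) i = π i := by
          intro i h1 h2
          simp [Equiv.swap_apply_of_ne_of_ne h1 h2]
        have hUe : U (π * Equiv.swap (fstPos hk s₀) (sndPos hk s₀)) = U π := by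
          refine Finset.prod_congr rfl fun s hs' => ?_
          have hne' : (s : ℕ) ≠ s₀ := fun h => Finset.ne_of_mem_erase hs' (Fin.ext h)
          simp only [hD]
          rw [hfix (fstPos hk s), hfix (sndPos hk s)]
          all_goals
            simp only [fstPos, sndPos, ne_eq, Fin.mk.injEq]
            omega
        have hTe : T (π * Equiv.swap (fstPos hk s₀) (sndPos hk s₀)) = T π := by
          refine Finset.prod_congr rfl fun l _ => ?_
          have := s₀.2
          rw [hfix (tailPos hk l)]
          all_goals
            simp only [fstPos, sndPos, tailPos, ne_eq, Fin.mk.injEq]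
            omega
        simp only [Equiv.coe_mulRight]
        rw [hUe, hTe]
        simp [Equiv.Perm.sign_swap hne]
      simp_rw [hsplit]
      change _ = 2 * ∑ π : Equiv.Perm (Fin m), ((Equiv.Perm.sign π : ℤ) : ℝ) *
        ((∏ s, D s π) * T π)
      simp_rw [hsplit', sub_mul, mul_sub]
      rw [Finset.sum_sub_distrib]
      erw [hswap]
      ring
  have := key Finset.univ
  simp only [Finset.mem_univ, if_true, Finset.card_univ, Fintype.card_fin] at this
  rw [wedge, wedge, this]
  ring

/-- The fully contracted form of Chern's expression: curvature forms with components `Rf` and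
one-forms given by the rows of `C`. -/
theorem sum_genDelta_wedge (Rf : Fin m → Fin m → Fin m → Fin m → ℝ)
    (C : Matrix (Fin m) (Fin m) ℝ) (c : ℝ) :
    ∑ α : Fin m → Fin m, genDelta α id * wedge hk
      (fun s (i j : Fin m) => ∑ γ, ∑ δ,
        Rf (α (fstPos hk s)) (α (sndPos hk s)) γ δ * (C γ i * C δ j))
      (fun l i => c * C (α (tailPos hk l)) i) id
    = (1 / 2 ^ k) * c ^ (m - 2 * k) * ((m - 2 * k).factorial : ℝ) *
      (∑ a : Fin (2 * k) → Fin m, ∑ b : Fin (2 * k) → Fin m, genDelta a b *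
        ∏ s, Rf (a (fstPos le_rfl s)) (a (sndPos le_rfl s))
          (b (fstPos le_rfl s)) (b (sndPos le_rfl s))) * C.det := by
  -- With α split as (a, t) and the curvature sums expanded over b, the sum over permutations is the
  -- determinant of C with rows selected by (b, t).
  have hw : ∀ (a : Fin (2 * k) → Fin m) (t : Fin (m - 2 * k) → Fin m), wedge hk
      (fun s (i j : Fin m) => ∑ γ, ∑ δ, Rf (combine hk a t (fstPos hk s))
        (combine hk a t (sndPos hk s)) γ δ * (C γ i * C δ j))
      (fun l i => c * C (combine hk a t (tailPos hk l)) i) id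
      = (1 / 2 ^ k) * c ^ (m - 2 * k) * ∑ b : Fin (2 * k) → Fin m,
        (∏ s, Rf (a (fstPos le_rfl s)) (a (sndPos le_rfl s))
          (b (fstPos le_rfl s)) (b (sndPos le_rfl s))) *
        (genDelta (combine hk b t) id * C.det) := by
    intro a t
    rw [wedge, mul_assoc]
    congr 1
    simp_rw [combine_fstPos, combine_sndPos, combine_tailPos, prod_sum_pairs,
      ← det_submatrix_eq_genDelta, Finset.prod_mul_distrib]
    rw [Finset.mul_sum]
    simp_rw [Finset.sum_mul, Finset.mul_sum]
    rw [Finset.sum_comm]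
    refine Finset.sum_congr rfl fun b _ => ?_
    rw [← Matrix.det_transpose, Matrix.det_apply', Finset.mul_sum, Finset.mul_sum]
    refine Finset.sum_congr rfl fun π _ => ?_
    simp only [Matrix.transpose_apply, Matrix.submatrix_apply, id]
    rw [prod_positions hk]
    simp_rw [combine_fstPos, combine_sndPos, combine_tailPos]
    rw [Finset.prod_mul_distrib, Finset.prod_const, Finset.card_univ, Fintype.card_fin]
    ring
  rw [← (combine_bijective hk (Fin m)).sum_comp, Fintype.sum_prod_type]
  simp_rw [hw]
  have h3 : ∀ a : Fin (2 * k) → Fin m,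
      ∑ t : Fin (m - 2 * k) → Fin m, genDelta (combine hk a t) id *
        ((1 / 2 ^ k) * c ^ (m - 2 * k) * ∑ b : Fin (2 * k) → Fin m,
        (∏ s, Rf (a (fstPos le_rfl s)) (a (sndPos le_rfl s))
          (b (fstPos le_rfl s)) (b (sndPos le_rfl s))) *
        (genDelta (combine hk b t) id * C.det))
      = (1 / 2 ^ k) * c ^ (m - 2 * k) * ((m - 2 * k).factorial : ℝ) *
        (∑ b : Fin (2 * k) → Fin m, genDelta a b *
        ∏ s, Rf (a (fstPos le_rfl s)) (a (sndPos le_rfl s))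
          (b (fstPos le_rfl s)) (b (sndPos le_rfl s))) * C.det := by
    intro a
    simp_rw [Finset.mul_sum, Finset.sum_mul]
    rw [Finset.sum_comm]
    refine Finset.sum_congr rfl fun b _ => ?_
    have h4 := sum_genDelta_combine hk a b
    -- The symbol from Φ_k and the one from the row selection share the tail t, so their product is
    -- a delta contracted over that tail.
    calc _ = (∑ t, genDelta (combine hk a t) id * genDelta (combine hk b t) id) *
          ((1 / 2 ^ k) * c ^ (m - 2 * k) * (∏ s, Rf (a (fstPos le_rfl s)) (a (sndPos le_rfl s))
          (b (fstPos le_rfl s)) (b (sndPos le_rfl s))) * C.det) := by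
            rw [Finset.sum_mul]
            exact Finset.sum_congr rfl fun t _ => by ring
      _ = _ := by
        rw [Finset.sum_congr rfl fun t _ => genDelta_id_mul _ _, h4]
        ring
  rw [Finset.sum_congr rfl fun a _ => h3 a, ← Finset.sum_mul, ← Finset.mul_sum]

end Wedge

/-! ### Adapted frames and the exact leading term -/

section Frame
variable {m : ℕ} {G : Euc (m + 1) → Matrix (Fin (m + 1)) (Fin (m + 1)) ℝ}
  {x v : Euc (m + 1)} {e : Fin (m + 1) → Euc (m + 1)}

/-- The matrix whose columns are the vectors of a frame. -/
def frameMatrix {n : ℕ} (e : Fin n → Euc n) : Matrix (Fin n) (Fin n) ℝ :=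
  Matrix.of fun i a => e a i

theorem metricAt_eq_sum {n : ℕ} (G : Euc n → Matrix (Fin n) (Fin n) ℝ) (x : Euc n)
    (e : Fin n → Euc n) (a : Fin n) (u : Euc n) :
    metricAt G x (e a) u = ∑ j, ((frameMatrix e).transpose * G x) a j * u j := by
  simp only [metricAt, Matrix.mul_apply, Matrix.transpose_apply, frameMatrix, Matrix.of_apply,
    Finset.sum_mul]
  rw [Finset.sum_comm]
  refine Finset.sum_congr rfl fun j _ => Finset.sum_congr rfl fun i _ => ?_
  ring

/-- The rows of FᵀG are the coframe g(e_a, ·), so orthonormality says that coframe and frame are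
inverse matrices. -/
theorem IsAdaptedFrame.mul_eq_one (he : IsAdaptedFrame G x v e) :
    ((frameMatrix e).transpose * G x) * frameMatrix e = 1 := by
  ext a b
  rw [Matrix.mul_apply, Matrix.one_apply, ← he.1 a b, metricAt_eq_sum]
  rfl

theorem IsAdaptedFrame.mul_eq_one' (he : IsAdaptedFrame G x v e) :
    frameMatrix e * ((frameMatrix e).transpose * G x) = 1 :=
  mul_eq_one_comm.mp he.mul_eq_one

theorem IsAdaptedFrame.inv_eq (he : IsAdaptedFrame G x v e) :
    (G x)⁻¹ = frameMatrix e * (frameMatrix e).transpose :=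
  Matrix.inv_eq_left_inv (by rw [Matrix.mul_assoc]; exact he.mul_eq_one')

theorem sum_four {ι : Type*} [Fintype ι] (f : ι → ι → ι → ι → ℝ) :
    ∑ a, ∑ b, ∑ c, ∑ d, f a b c d = ∑ z : ι × ι × ι × ι, f z.1 z.2.1 z.2.2.1 z.2.2.2 := by
  simp [Fintype.sum_prod_type]

theorem sum_four_mul {ι : Type*} [Fintype ι] (A B C D : ι → ℝ) :
    ∑ a, ∑ b, ∑ c, ∑ d, A a * B b * C c * D d
      = (∑ a, A a) * (∑ a, B a) * (∑ a, C a) * ∑ a, D a := by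
  simp only [← Finset.mul_sum, ← Finset.sum_mul]

/-- In an orthonormal frame upper and lower indices agree, because g⁻¹ = FFᵀ. Fully lowered frame
components thus determine the mixed coordinate components through coframe and frame. -/
theorem riemannMixed_eq_frame (he : IsAdaptedFrame G x v e) (i j k l : Fin (m + 1)) :
    riemannMixed G i j k l x = ∑ α, ∑ α', ∑ β, ∑ β',
      riemannAt G x (e α) (e α') (e β) (e β') *
      (((frameMatrix e).transpose * G x) α i * ((frameMatrix e).transpose * G x) α' j *
        (frameMatrix e k β * frameMatrix e l β')) := by
  set P := (frameMatrix e).transpose * G x with hP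
  set F := frameMatrix e with hF
  have hFP : ∀ i' i, ∑ α, F i' α * P α i = if i' = i then (1:ℝ) else 0 := fun i' i => by
    rw [← Matrix.mul_apply, he.mul_eq_one', Matrix.one_apply]
  have hinv : ∀ i j, (G x)⁻¹ i j = ∑ β, F i β * F j β := fun i j => by
    rw [he.inv_eq, Matrix.mul_apply]
    rfl
  have hR : ∀ α α' β β', riemannAt G x (e α) (e α') (e β) (e β') =
      ∑ i', ∑ j', ∑ p, ∑ q, riemann G i' j' p q x * F i' α * F j' α' * F p β * F q β' :=
    fun _ _ _ _ => rfl
  simp_rw [hR, Finset.sum_mul]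
  rw [sum_four]
  simp_rw [sum_four (ι := Fin (m + 1)) (fun i' j' p q => _ * _)]
  rw [Finset.sum_comm]
  -- For fixed coordinate indices the sum over frame indices factors: two factors FP are identities,
  -- and two factors FFᵀ are g⁻¹.
  have h1 : ∀ y : Fin (m+1) × Fin (m+1) × Fin (m+1) × Fin (m+1),
      ∑ z : Fin (m+1) × Fin (m+1) × Fin (m+1) × Fin (m+1),
        riemann G y.1 y.2.1 y.2.2.1 y.2.2.2 x * F y.1 z.1 * F y.2.1 z.2.1 * F y.2.2.1 z.2.2.1 *
          F y.2.2.2 z.2.2.2 * (P z.1 i * P z.2.1 j * (F k z.2.2.1 * F l z.2.2.2))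
      = riemann G y.1 y.2.1 y.2.2.1 y.2.2.2 x * ((if y.1 = i then 1 else 0) *
        (if y.2.1 = j then 1 else 0) * (G x)⁻¹ k y.2.2.1 * (G x)⁻¹ l y.2.2.2) := by
    intro y
    rw [← hFP, ← hFP, hinv, hinv, ← sum_four_mul, sum_four, Finset.mul_sum]
    exact Finset.sum_congr rfl fun z _ => by ring
  rw [Finset.sum_congr rfl fun y _ => h1 y]
  rw [← sum_four (fun i' j' p q => riemann G i' j' p q x * ((if i' = i then 1 else 0) *
        (if j' = j then 1 else 0) * (G x)⁻¹ k p * (G x)⁻¹ l q))]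
  rw [Finset.sum_eq_single i, Finset.sum_eq_single j]
  · rw [riemannMixed]
    refine Finset.sum_congr rfl fun p _ => Finset.sum_congr rfl fun q _ => ?_
    simp
    ring
  · intro b _ hb
    simp [hb]
  · simp
  · intro b _ hb
    simp [hb]
  · simp

theorem sum_genDelta_cons {n r : ℕ} (P Q : Matrix (Fin n) (Fin n) ℝ) (hPQ : P * Q = 1)
    (i : Fin n) (α β : Fin r → Fin n) :
    ∑ p, ∑ j, ∑ a : Fin r → Fin n, ∑ b : Fin r → Fin n,
      genDelta (Fin.cons p a : Fin (r + 1) → Fin n) (Fin.cons j b : Fin (r + 1) → Fin n) *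
        ((P i p * ∏ t, P (α t) (a t)) * (Q j i * ∏ t, Q (b t) (β t)))
      = genDelta (Fin.cons i α : Fin (r + 1) → Fin n) (Fin.cons i β : Fin (r + 1) → Fin n) := by
  rw [← sum_genDelta_mul_prod P Q hPQ,
    ← (Fin.consEquiv (fun _ : Fin (r + 1) => Fin n)).sum_comp, Fintype.sum_prod_type]
  refine Finset.sum_congr rfl fun p _ => ?_
  rw [Finset.sum_comm]
  refine Finset.sum_congr rfl fun a _ => ?_
  rw [← (Fin.consEquiv (fun _ : Fin (r + 1) => Fin n)).sum_comp, Fintype.sum_prod_type]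
  refine Finset.sum_congr rfl fun j _ => Finset.sum_congr rfl fun b _ => ?_
  simp [Fin.prod_univ_succ, Fin.consEquiv]

/-- The Lovelock curvature in the direction of the last vector of an adapted frame. -/
theorem lovelockAt_eq_frame (k : ℕ) (he : IsAdaptedFrame G x v e) :
    lovelockAt k G x v v = -(1 / 2 ^ (k + 1)) *
      ∑ a : Fin (2 * k) → Fin m, ∑ b : Fin (2 * k) → Fin m, genDelta a b *
        ∏ s, riemannAt G x (e (a (fstPos le_rfl s)).castSucc) (e (a (sndPos le_rfl s)).castSucc)
          (e (b (fstPos le_rfl s)).castSucc) (e (b (sndPos le_rfl s)).castSucc) := by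
  set P := (frameMatrix e).transpose * G x with hP
  set F := frameMatrix e with hF
  set L := Fin.last m with hL
  set K : (Fin (2 * k) → Fin (m + 1)) → (Fin (2 * k) → Fin (m + 1)) → ℝ := fun α β =>
    ∏ s, riemannAt G x (e (α (fstPos le_rfl s))) (e (α (sndPos le_rfl s)))
      (e (β (fstPos le_rfl s))) (e (β (sndPos le_rfl s))) with hK
  have hprod : ∀ a b : Fin (2 * k) → Fin (m + 1),
      ∏ s, riemannMixed G (a (fstPos le_rfl s)) (a (sndPos le_rfl s))
        (b (fstPos le_rfl s)) (b (sndPos le_rfl s)) x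
      = ∑ α, ∑ β, K α β * ((∏ t, P (α t) (a t)) * ∏ t, F (b t) (β t)) := by
    intro a b
    simp_rw [riemannMixed_eq_frame he, prod_sum_pairs]
    refine Finset.sum_congr rfl fun α _ => Finset.sum_congr rfl fun β _ => ?_
    rw [prod_pairs (fun t => P (α t) (a t)), prod_pairs (fun t => F (b t) (β t)), hK,
      ← Finset.prod_mul_distrib, ← Finset.prod_mul_distrib]
  have hv : ∀ i, v i = F i L := fun i => by rw [← he.2.2]; rfl
  -- The covector g(v, ·) is the last row of the coframe matrix, v the last column of the frame
  -- matrix.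
  have h1 : lovelockAt k G x v v = ∑ p, ∑ j, P L p * F j L * lovelockMixed k G p j x := by
    simp only [lovelockAt, hv, Finset.sum_mul]
    rw [Finset.sum_comm]
    simp_rw [Finset.sum_comm (s := Finset.univ) (t := Finset.univ) (f := fun i p => _ * F i L * F _ L)]
    rw [Finset.sum_comm]
    refine Finset.sum_congr rfl fun p _ => Finset.sum_congr rfl fun j _ => ?_
    rw [hP, Matrix.mul_apply, Finset.sum_mul, Finset.sum_mul]
    refine Finset.sum_congr rfl fun i _ => ?_
    rw [Matrix.transpose_apply]
    ring
  -- Basis invariance of the delta moves the whole contraction into the frame, with the normal index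
  -- L in front.
  have h2 : lovelockAt k G x v v = -(1 / 2 ^ (k + 1)) * ∑ α, ∑ β, K α β *
      genDelta (Fin.cons L α : Fin (2 * k + 1) → Fin (m + 1))
        (Fin.cons L β : Fin (2 * k + 1) → Fin (m + 1)) := by
    rw [h1]
    simp_rw [← sum_genDelta_cons P F he.mul_eq_one, lovelockMixed, hprod]
    simp_rw [Finset.mul_sum]
    set f : Fin (m + 1) → Fin (m + 1) → (Fin (2 * k) → Fin (m + 1)) → (Fin (2 * k) → Fin (m + 1)) →
      (Fin (2 * k) → Fin (m + 1)) → (Fin (2 * k) → Fin (m + 1)) → ℝ := fun p j a b α β =>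
        -(1 / 2 ^ (k + 1)) * (K α β *
          (genDelta (Fin.cons p a : Fin (2 * k + 1) → Fin (m + 1))
            (Fin.cons j b : Fin (2 * k + 1) → Fin (m + 1)) *
            ((P L p * ∏ t, P (α t) (a t)) * (F j L * ∏ t, F (b t) (β t))))) with hf
    calc _ = ∑ p, ∑ j, ∑ a, ∑ b, ∑ α, ∑ β, f p j a b α β := by
          iterate 6 refine Finset.sum_congr rfl fun _ _ => ?_
          rw [hf]
          ring
      _ = ∑ y : Fin (m + 1) × Fin (m + 1) × (Fin (2 * k) → Fin (m + 1)) ×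
            (Fin (2 * k) → Fin (m + 1)),
            ∑ z : (Fin (2 * k) → Fin (m + 1)) × (Fin (2 * k) → Fin (m + 1)),
            f y.1 y.2.1 y.2.2.1 y.2.2.2 z.1 z.2 := by
          simp only [Fintype.sum_prod_type]
      _ = _ := by
          rw [Finset.sum_comm]
          simp only [Fintype.sum_prod_type]
          rfl
  rw [h2]
  congr 1
  have hinj : Function.Injective
      (fun (a : Fin (2 * k) → Fin m) (t : Fin (2 * k)) => (a t).castSucc) := by
    intro a b h
    funext t
    exact Fin.castSucc_injective m (congrFun h t)
  -- A list that is not purely tangential repeats the leading index L, and the delta vanishes on it.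
  have hrange : ∀ α : Fin (2 * k) → Fin (m + 1), α ∉ Set.range
      (fun (a : Fin (2 * k) → Fin m) (t : Fin (2 * k)) => (a t).castSucc) → ∃ t, α t = L := by
    intro α hα
    by_contra! h
    exact hα ⟨fun t => (α t).castPred (h t), by simp⟩
  symm
  refine Fintype.sum_of_injective _ hinj _ _ ?_ ?_
  · intro α hα
    obtain ⟨t, ht⟩ := hrange α hα
    refine Finset.sum_eq_zero fun β _ => ?_
    rw [genDelta_eq_zero_left (s := 0) (t := t.succ) (Fin.succ_ne_zero t).symm (by simp [ht]),
      mul_zero]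
  · intro a
    refine Fintype.sum_of_injective _ hinj _ _ ?_ ?_
    · intro β hβ
      obtain ⟨t, ht⟩ := hrange β hβ
      rw [genDelta_eq_zero_right (s := 0) (t := t.succ) (Fin.succ_ne_zero t).symm (by simp [ht]),
        mul_zero]
    · intro b
      rw [hL, genDelta_cons_last_castSucc, mul_comm]

/-- Components of vectors orthogonal to the last vector of a frame. -/
noncomputable def tangentComponents (G : Euc (m + 1) → Matrix (Fin (m + 1)) (Fin (m + 1)) ℝ)
    (x : Euc (m + 1)) (e : Fin (m + 1) → Euc (m + 1)) (X : Fin m → Euc (m + 1)) :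
    Matrix (Fin m) (Fin m) ℝ :=
  Matrix.of fun b s => metricAt G x (e b.castSucc) (X s)

/-- The coframe element ω_n vanishes on the X s, so γ and δ run over tangential indices only. The
form B(i,j) - B(j,i) is what `wedge_antisymm` takes. -/
theorem curvForm_eq_sub {X : Fin m → Euc (m + 1)}
    (hX : ∀ s, metricAt G x (e (Fin.last m)) (X s) = 0) (α β : Fin (m + 1)) (i j : Fin m)
    (η η' : Euc (m + 1)) :
    curvForm G x e α β (X i, η) (X j, η') =
      (∑ γ : Fin m, ∑ δ : Fin m, (1 / 2) * riemannAt G x (e α) (e β) (e γ.castSucc) (e δ.castSucc) *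
        (tangentComponents G x e X γ i * tangentComponents G x e X δ j))
      - ∑ γ : Fin m, ∑ δ : Fin m,
        (1 / 2) * riemannAt G x (e α) (e β) (e γ.castSucc) (e δ.castSucc) *
        (tangentComponents G x e X γ j * tangentComponents G x e X δ i) := by
  rw [curvForm]
  simp only [Fin.sum_univ_castSucc, hX, mul_zero, zero_mul, sub_zero, add_zero,
    Finset.sum_const_zero]
  rw [← Finset.sum_sub_distrib, Finset.mul_sum]
  refine Finset.sum_congr rfl fun γ _ => ?_
  rw [← Finset.sum_sub_distrib, Finset.mul_sum]
  refine Finset.sum_congr rfl fun δ _ => ?_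
  simp only [tangentComponents, Matrix.of_apply]
  ring

/-- Chern's expression with the connection forms replaced by multiples of the coframe. -/
theorem sum_genDelta_wedge_curvForm {k : ℕ} (hk : 2 * k ≤ m) {X : Fin m → Euc (m + 1)}
    (hX : ∀ s, metricAt G x (e (Fin.last m)) (X s) = 0) (Y : Fin m → Euc (m + 1)) (c : ℝ) :
    ∑ α : Fin m → Fin m, genDelta α id * wedge hk
      (fun s => curvForm G x e (α (fstPos hk s)).castSucc (α (sndPos hk s)).castSucc)
      (fun l Z => c * metricAt G x (e (α (tailPos hk l)).castSucc) Z.1) (fun s => (X s, Y s))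
    = (1 / 2 ^ k) * c ^ (m - 2 * k) * ((m - 2 * k).factorial : ℝ) *
      (∑ a : Fin (2 * k) → Fin m, ∑ b : Fin (2 * k) → Fin m, genDelta a b *
        ∏ s, riemannAt G x (e (a (fstPos le_rfl s)).castSucc) (e (a (sndPos le_rfl s)).castSucc)
          (e (b (fstPos le_rfl s)).castSucc) (e (b (sndPos le_rfl s)).castSucc)) *
      (tangentComponents G x e X).det := by
  have h := sum_genDelta_wedge hk (fun α β γ δ => (1 / 2) *
    riemannAt G x (e α.castSucc) (e β.castSucc) (e γ.castSucc) (e δ.castSucc))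
    (tangentComponents G x e X) c
  have h1 : ∀ α : Fin m → Fin m, wedge hk
      (fun s => curvForm G x e (α (fstPos hk s)).castSucc (α (sndPos hk s)).castSucc)
      (fun l Z => c * metricAt G x (e (α (tailPos hk l)).castSucc) Z.1) (fun s => (X s, Y s))
      = 2 ^ k * wedge hk
      (fun s (i j : Fin m) => ∑ γ : Fin m, ∑ δ : Fin m,
        (1 / 2) * riemannAt G x (e (α (fstPos hk s)).castSucc) (e (α (sndPos hk s)).castSucc)
          (e γ.castSucc) (e δ.castSucc) *
        (tangentComponents G x e X γ i * tangentComponents G x e X δ j))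
      (fun l i => c * tangentComponents G x e X (α (tailPos hk l)) i) id := by
    intro α
    rw [← wedge_antisymm]
    simp only [wedge, curvForm_eq_sub hX, id]
    rfl
  simp_rw [h1]
  have h2 : ∀ (α : Fin m → Fin m) (w : ℝ), genDelta α id * (2 ^ k * w)
      = 2 ^ k * (genDelta α id * w) := fun α w => by ring
  simp_rw [h2]
  rw [← Finset.mul_sum, h]
  simp_rw [Finset.prod_mul_distrib, Finset.prod_const, Finset.card_univ, Fintype.card_fin]
  have h3 : ∀ (a b : Fin (2 * k) → Fin m) (w : ℝ), genDelta a b * ((1 / 2) ^ k * w)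
      = (1 / 2) ^ k * (genDelta a b * w) := fun a b w => by ring
  simp_rw [h3, ← Finset.mul_sum]
  -- The factor 2 from antisymmetrizing each curvature form cancels the ½ in Ω.
  have h4 : (2 : ℝ) ^ k * (1 / 2) ^ k = 1 := by
    rw [← mul_pow]
    norm_num
  linear_combination ((1 / 2 ^ k) * c ^ (m - 2 * k) * ((m - 2 * k).factorial : ℝ) *
    (∑ a : Fin (2 * k) → Fin m, ∑ b : Fin (2 * k) → Fin m, genDelta a b *
        ∏ s, riemannAt G x (e (a (fstPos le_rfl s)).castSucc) (e (a (sndPos le_rfl s)).castSucc)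
          (e (b (fstPos le_rfl s)).castSucc) (e (b (sndPos le_rfl s)).castSucc)) *
      (tangentComponents G x e X).det) * h4

/-- The coframe matrix P has determinant √(det g); positive orientation fixes the sign of the root.
Multiplying the matrix (ν, X) by P turns its first column into the last basis vector, whose cofactor
carries (-1)^m. -/
theorem areaForm_eq_det (he : IsAdaptedFrame G x (unitNormal G x) e)
    (X : Fin m → Euc (m + 1)) :
    areaForm G x X = (-1) ^ m * (tangentComponents G x e X).det := by
  set P := (frameMatrix e).transpose * G x with hP
  set F := frameMatrix e with hF
  have hFpos : 0 < F.det := he.2.1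
  have hdet : F.det * (G x).det * F.det = 1 := by
    have := congrArg Matrix.det he.mul_eq_one
    rwa [Matrix.det_mul, Matrix.det_mul, Matrix.det_transpose, Matrix.det_one] at this
  have hsqrt : Real.sqrt (G x).det = F.det * (G x).det := by
    have h0 : (G x).det = (F.det * (G x).det) ^ 2 := by
      linear_combination -(G x).det * hdet
    have hG : 0 < (G x).det := by
      by_contra h
      push Not at h
      nlinarith [mul_pos hFpos hFpos]
    conv_lhs => rw [h0]
    exact Real.sqrt_sq (by positivity)
  have hPd : P.det = F.det * (G x).det := by rw [hP, Matrix.det_mul, Matrix.det_transpose]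
  rw [areaForm, hsqrt, ← hPd, ← Matrix.det_mul, Matrix.det_succ_column_zero]
  have hcol0 : ∀ i, (P * Matrix.of fun i a =>
      (Fin.cons (unitNormal G x) X : Fin (m + 1) → Euc (m + 1)) a i) i 0
      = if i = Fin.last m then 1 else 0 := by
    intro i
    have h := metricAt_eq_sum G x e i (e (Fin.last m))
    rw [he.1] at h
    rw [Matrix.mul_apply, h]
    simp [he.2.2, hP, hF]
  simp only [hcol0]
  rw [Finset.sum_eq_single (Fin.last m)]
  · simp only [if_true, mul_one, Fin.val_last]
    congr 2
    ext b s
    simp only [Matrix.submatrix_apply, Matrix.mul_apply, tangentComponents, Matrix.of_apply]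
    rw [metricAt_eq_sum]
    simp [hP, hF, Matrix.mul_apply]
  · intro i _ hi
    simp [hi]
  · simp

/-- The leading term of the pull-back of Chern's form. -/
theorem leading_term_eq {k : ℕ} (hk : 2 * k ≤ m) (hx : x ≠ 0)
    (he : IsAdaptedFrame G x (unitNormal G x) e) {X : Fin m → Euc (m + 1)}
    (hX : ∀ s, metricAt G x (e (Fin.last m)) (X s) = 0) (Y : Fin m → Euc (m + 1)) :
    ‖x‖ ^ (m + 1 - 2 * k) * ∑ α : Fin m → Fin m, genDelta α id * wedge hk
      (fun s => curvForm G x e (α (fstPos hk s)).castSucc (α (sndPos hk s)).castSucc)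
      (fun l Z => -‖x‖⁻¹ * metricAt G x (e (α (tailPos hk l)).castSucc) Z.1) (fun s => (X s, Y s))
    = -2 * ((m - 2 * k).factorial : ℝ) *
        (‖x‖ * lovelockAt k G x (unitNormal G x) (unitNormal G x)) * areaForm G x X := by
  rw [sum_genDelta_wedge_curvForm hk hX, lovelockAt_eq_frame k he, areaForm_eq_det he X]
  -- One power of r survives, and since 2k is even the sign is that of the area form.
  have hr : ‖x‖ ^ (m + 1 - 2 * k) * (-‖x‖⁻¹) ^ (m - 2 * k) = ‖x‖ * (-1) ^ m := by
    have h1 : m + 1 - 2 * k = (m - 2 * k) + 1 := by omega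
    have h2 : (-1 : ℝ) ^ (m - 2 * k) = (-1) ^ m := by
      conv_rhs => rw [← Nat.sub_add_cancel hk, pow_add, pow_mul]
      simp
    have h3 : ‖x‖ ≠ 0 := norm_ne_zero_iff.mpr hx
    rw [h1, pow_succ', mul_assoc, ← mul_pow, ← h2]
    congr 2
    field_simp
  rw [pow_succ]
  set S := ∑ a : Fin (2 * k) → Fin m, ∑ b : Fin (2 * k) → Fin m, genDelta a b *
        ∏ s, riemannAt G x (e (a (fstPos le_rfl s)).castSucc) (e (a (sndPos le_rfl s)).castSucc)
          (e (b (fstPos le_rfl s)).castSucc) (e (b (sndPos le_rfl s)).castSucc)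
  have h5 : (1 : ℝ) / (2 ^ k * 2) = (1 / 2 ^ k) * (1 / 2) := by
    rw [one_div_mul_one_div]
  rw [h5]
  linear_combination (1 / 2 ^ k) * ((m - 2 * k).factorial : ℝ) * S *
    (tangentComponents G x e X).det * hr

end Frame

/-! ### Pointwise bounds for products, wedges and frame components -/

section Bounds

theorem abs_sum_le_card {n : ℕ} {f : Fin n → ℝ} {c : ℝ} (h : ∀ i, |f i| ≤ c) :
    |∑ i, f i| ≤ n * c := by
  refine (Finset.abs_sum_le_sum_abs _ _).trans ((Finset.sum_le_card_nsmul _ _ c fun i _ => h i).trans ?_)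
  simp

/-- Telescoping: each factor is exchanged once, at relative cost h. -/
theorem abs_prod_sub_prod_le {κ : Type*} (S : Finset κ) {a b c : κ → ℝ} {h : ℝ} (hh : 0 ≤ h)
    (ha : ∀ i ∈ S, |a i| ≤ c i) (hb : ∀ i ∈ S, |b i| ≤ c i)
    (hab : ∀ i ∈ S, |a i - b i| ≤ h * c i) :
    |∏ i ∈ S, a i - ∏ i ∈ S, b i| ≤ S.card * h * ∏ i ∈ S, c i := by
  classical
  induction S using Finset.induction_on with
  | empty => simp
  | insert j S hj ih =>
    have hc : ∀ i ∈ insert j S, 0 ≤ c i := fun i hi => (abs_nonneg _).trans (ha i hi)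
    have ih' := ih (fun i hi => ha i (by simp [hi])) (fun i hi => hb i (by simp [hi]))
      (fun i hi => hab i (by simp [hi]))
    have hP : |∏ i ∈ S, a i| ≤ ∏ i ∈ S, c i := by
      rw [Finset.abs_prod]
      exact Finset.prod_le_prod (fun i _ => abs_nonneg _) fun i hi => ha i (by simp [hi])
    rw [Finset.prod_insert hj, Finset.prod_insert hj, Finset.prod_insert hj,
      Finset.card_insert_of_notMem hj]
    have e : a j * ∏ i ∈ S, a i - b j * ∏ i ∈ S, b i
        = (a j - b j) * ∏ i ∈ S, a i + b j * (∏ i ∈ S, a i - ∏ i ∈ S, b i) := by ring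
    rw [e]
    refine (abs_add_le _ _).trans ?_
    rw [abs_mul, abs_mul]
    have h1 := mul_le_mul (hab j (by simp)) hP (abs_nonneg _)
      (mul_nonneg hh (hc j (by simp)))
    have h2 := mul_le_mul (hb j (by simp)) ih' (abs_nonneg _) (hc j (by simp))
    refine (add_le_add h1 h2).trans (le_of_eq ?_)
    push_cast
    ring

/-- Every permutation uses each vector exactly once, so the factors N i multiply to the full
product, and the relative error h of the one-forms enters linearly. -/
theorem abs_wedge_sub_le {V : Type*} {m k : ℕ} (hk : 2 * k ≤ m) {Θ : Fin k → V → V → ℝ}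
    {θ θ' : Fin (m - 2 * k) → V → ℝ} {X : Fin m → V} {N : Fin m → ℝ} {A B h : ℝ}
    (hh : 0 ≤ h) (hΘ : ∀ s i j, |Θ s (X i) (X j)| ≤ A * (N i * N j))
    (hθ : ∀ l i, |θ l (X i)| ≤ B * N i) (hθ' : ∀ l i, |θ' l (X i)| ≤ B * N i)
    (hsub : ∀ l i, |θ l (X i) - θ' l (X i)| ≤ h * (B * N i)) :
    |wedge hk Θ θ X - wedge hk Θ θ' X|
      ≤ m.factorial * (A ^ k * ((m - 2 * k : ℕ) * h * B ^ (m - 2 * k)) * ∏ i, N i) := by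
  have key : ∀ π : Equiv.Perm (Fin m),
      |(∏ s, Θ s (X (π (fstPos hk s))) (X (π (sndPos hk s)))) *
        (∏ l, θ l (X (π (tailPos hk l))) - ∏ l, θ' l (X (π (tailPos hk l))))|
      ≤ A ^ k * ((m - 2 * k : ℕ) * h * B ^ (m - 2 * k)) * ∏ i, N i := by
    intro π
    have h1 : |∏ s, Θ s (X (π (fstPos hk s))) (X (π (sndPos hk s)))|
        ≤ ∏ s : Fin k, A * (N (π (fstPos hk s)) * N (π (sndPos hk s))) := by
      rw [Finset.abs_prod]
      exact Finset.prod_le_prod (fun i _ => abs_nonneg _) fun s _ => hΘ s _ _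
    have h2 := abs_prod_sub_prod_le Finset.univ hh
      (fun l (_ : l ∈ (Finset.univ : Finset (Fin (m - 2 * k)))) => hθ l (π (tailPos hk l)))
      (fun l _ => hθ' l _) (fun l _ => hsub l _)
    rw [abs_mul]
    refine (mul_le_mul h1 h2 (abs_nonneg _) ((abs_nonneg _).trans h1)).trans (le_of_eq ?_)
    rw [← Equiv.prod_comp π N, prod_positions hk (fun i => N (π i))]
    simp only [Finset.prod_mul_distrib, Finset.prod_const, Finset.card_univ, Fintype.card_fin]
    ring
  have hsum : wedge hk Θ θ X - wedge hk Θ θ' X = (1 / 2 ^ k) *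
      ∑ π : Equiv.Perm (Fin m), ((Equiv.Perm.sign π : ℤ) : ℝ) *
      ((∏ s, Θ s (X (π (fstPos hk s))) (X (π (sndPos hk s)))) *
        (∏ l, θ l (X (π (tailPos hk l))) - ∏ l, θ' l (X (π (tailPos hk l))))) := by
    rw [wedge, wedge, ← mul_sub, ← Finset.sum_sub_distrib]
    congr 1
    exact Finset.sum_congr rfl fun π _ => by ring
  rw [hsum, abs_mul]
  have h2k : |(1 : ℝ) / 2 ^ k| ≤ 1 := by
    rw [abs_of_nonneg (by positivity)]
    exact div_le_one_of_le₀ (one_le_pow₀ (by norm_num)) (by positivity)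
  refine (mul_le_of_le_one_left (abs_nonneg _) h2k).trans ?_
  refine (Finset.abs_sum_le_sum_abs _ _).trans
    ((Finset.sum_le_card_nsmul _ _ (A ^ k * ((m - 2 * k : ℕ) * h * B ^ (m - 2 * k)) * ∏ i, N i)
      fun π _ => ?_).trans (le_of_eq ?_))
  · rw [abs_mul]
    have : |((Equiv.Perm.sign π : ℤ) : ℝ)| = 1 := by
      rcases Int.units_eq_one_or (Equiv.Perm.sign π) with h | h <;> simp [h]
    rw [this, one_mul]
    exact key π
  · simp [Finset.card_univ, Fintype.card_perm]

theorem abs_det_le_prod {m : ℕ} {C : Matrix (Fin m) (Fin m) ℝ} {N : Fin m → ℝ}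
    (hC : ∀ i s, |C i s| ≤ N s) : |C.det| ≤ m.factorial * ∏ s, N s := by
  rw [Matrix.det_apply']
  refine (Finset.abs_sum_le_sum_abs _ _).trans
    ((Finset.sum_le_card_nsmul _ _ (∏ s, N s) fun π _ => ?_).trans (le_of_eq ?_))
  · rw [abs_mul]
    have : |((Equiv.Perm.sign π : ℤ) : ℝ)| = 1 := by
      rcases Int.units_eq_one_or (Equiv.Perm.sign π) with h | h <;> simp [h]
    rw [this, one_mul, Finset.abs_prod]
    exact Finset.prod_le_prod (fun i _ => abs_nonneg _) fun s _ => hC _ _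
  · simp [Finset.card_univ, Fintype.card_perm]

theorem abs_metricAt_le {n : ℕ} {G : Euc n → Matrix (Fin n) (Fin n) ℝ} {x u v : Euc n}
    {K a b : ℝ} (hG : ∀ i j, |G x i j| ≤ K) (hu : ∀ i, |u i| ≤ a) (hv : ∀ i, |v i| ≤ b) :
    |metricAt G x u v| ≤ n * (n * (K * a * b)) := by
  refine abs_sum_le_card fun i => abs_sum_le_card fun j => ?_
  have hK := (abs_nonneg _).trans (hG i j)
  have ha := (abs_nonneg _).trans (hu i)
  rw [abs_mul, abs_mul]
  gcongr
  exacts [hG i j, hu i, hv j]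

theorem abs_riemannAt_le {n : ℕ} {G : Euc n → Matrix (Fin n) (Fin n) ℝ} {x a b c d : Euc n}
    {ρ K : ℝ} (hR : ∀ i j k l, |riemann G i j k l x| ≤ ρ) (ha : ∀ i, |a i| ≤ K)
    (hb : ∀ i, |b i| ≤ K) (hc : ∀ i, |c i| ≤ K) (hd : ∀ i, |d i| ≤ K) :
    |riemannAt G x a b c d| ≤ n * (n * (n * (n * (ρ * K * K * K * K)))) := by
  refine abs_sum_le_card fun i => abs_sum_le_card fun j => abs_sum_le_card fun k =>
    abs_sum_le_card fun l => ?_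
  have hρ := (abs_nonneg _).trans (hR i j k l)
  have hK := (abs_nonneg _).trans (ha i)
  rw [abs_mul, abs_mul, abs_mul, abs_mul]
  gcongr
  exacts [hR i j k l, ha i, hb j, hc k, hd l]

theorem abs_curvForm_le {n : ℕ} {G : Euc n → Matrix (Fin n) (Fin n) ℝ} {x : Euc n}
    {e : Fin n → Euc n} {ρ c : ℝ} (hc : 0 ≤ c)
    (hR : ∀ a b c d, |riemannAt G x (e a) (e b) (e c) (e d)| ≤ ρ)
    (he : ∀ a u, |metricAt G x (e a) u| ≤ c * ‖u‖) (α β : Fin n) (Z W : Euc n × Euc n) :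
    |curvForm G x e α β Z W| ≤ n * (n * (ρ * (c * c))) * (‖Z.1‖ * ‖W.1‖) := by
  rw [curvForm, abs_mul]
  have h : |∑ γ, ∑ δ, riemannAt G x (e α) (e β) (e γ) (e δ) *
    (metricAt G x (e γ) Z.1 * metricAt G x (e δ) W.1
      - metricAt G x (e γ) W.1 * metricAt G x (e δ) Z.1)|
      ≤ n * (n * (ρ * (2 * ((c * ‖Z.1‖) * (c * ‖W.1‖))))) := by
    refine abs_sum_le_card fun γ => abs_sum_le_card fun δ => ?_
    rw [abs_mul]
    refine mul_le_mul (hR _ _ _ _) ?_ (abs_nonneg _) ((abs_nonneg _).trans (hR α β γ δ))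
    refine (abs_sub _ _).trans ?_
    rw [abs_mul, abs_mul]
    have h1 := mul_le_mul (he γ Z.1) (he δ W.1) (abs_nonneg _) (by positivity)
    have h2 := mul_le_mul (he γ W.1) (he δ Z.1) (abs_nonneg _) (by positivity)
    linarith
  rw [abs_of_pos (by norm_num : (0:ℝ) < 1 / 2)]
  refine (mul_le_mul_of_nonneg_left h (by norm_num)).trans (le_of_eq ?_)
  ring

/-- The diagonal entry g^{ii} is the sum of the squares of the i-th components of the frame vectors.
The bound is therefore independent of the choice of frame. -/
theorem IsAdaptedFrame.abs_le {m : ℕ} {G : Euc (m + 1) → Matrix (Fin (m + 1)) (Fin (m + 1)) ℝ}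
    {x v : Euc (m + 1)} {e : Fin (m + 1) → Euc (m + 1)} (he : IsAdaptedFrame G x v e) {K : ℝ}
    (hK : 1 ≤ K) (hG : ∀ i j, |(G x)⁻¹ i j| ≤ K) (a i : Fin (m + 1)) : |e a i| ≤ K := by
  have h1 : (G x)⁻¹ i i = ∑ b, e b i * e b i := by
    rw [he.inv_eq, Matrix.mul_apply]
    rfl
  have h2 : e a i * e a i ≤ (G x)⁻¹ i i := by
    rw [h1]
    exact Finset.single_le_sum (f := fun b => e b i * e b i) (fun b _ => mul_self_nonneg _)
      (Finset.mem_univ a)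
  have h3 := (le_abs_self _).trans (hG i i)
  refine abs_le_of_sq_le_sq (by nlinarith) (by linarith)

end Bounds

/-! ### The asymptotic expansion and its integral over large spheres -/

section Estimates
open Asymptotics Bornology
variable {m : ℕ} {τ : ℝ} {G : Euc (m + 1) → Matrix (Fin (m + 1)) (Fin (m + 1)) ℝ}

theorem exists_eventually_bound {n : ℕ} {κ : Type*} [Finite κ] {s : ℝ} {f : κ → Euc n → ℝ}
    (hf : ∀ i, f i =O[cobounded (Euc n)] fun x => ‖x‖ ^ s) :
    ∃ K : ℝ, 1 ≤ K ∧ ∀ᶠ x in cobounded (Euc n), ∀ i, |f i x| ≤ K * ‖x‖ ^ s := by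
  have := Fintype.ofFinite κ
  have h : (fun x i => f i x) =O[cobounded (Euc n)] fun x => ‖x‖ ^ s := isBigO_pi.mpr hf
  obtain ⟨K, hK⟩ := h.bound
  refine ⟨max K 1, le_max_right _ _, ?_⟩
  filter_upwards [hK] with x hx i
  rw [Real.norm_of_nonneg (by positivity : 0 ≤ ‖x‖ ^ s)] at hx
  refine (norm_le_pi_norm (fun i => f i x) i).trans (hx.trans ?_)
  gcongr
  exact le_max_left _ _

/-- Uniform bounds for the geometry of a decaying metric far out. -/
structure GeometryBounds (K τ : ℝ) (G : Euc (m + 1) → Matrix (Fin (m + 1)) (Fin (m + 1)) ℝ)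
    (x : Euc (m + 1)) : Prop where
  one_lt : 1 < ‖x‖
  one_le : 1 ≤ K
  entry : ∀ i j, |G x i j| ≤ K
  inv : ∀ i j, |(G x)⁻¹ i j| ≤ K
  riemann : ∀ i j k l, |riemann G i j k l x| ≤ K * ‖x‖ ^ (-τ - 2)
  shape : ∀ l p, |shapeError G l p x| ≤ K * ‖x‖ ^ (-τ - 1)
  connection : ∀ X : Euc (m + 1), inner ℝ x X = 0 →
    ∀ l, connectionMap G x (unitNormal G x) (X, fderiv ℝ (unitNormal G) x X) l
      = ‖x‖⁻¹ * X l + ∑ p, shapeError G l p x * X p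
  orthogonal : ∀ X : Euc (m + 1), inner ℝ x X = 0 → metricAt G x (unitNormal G x) X = 0

theorem IsDecaying.exists_geometryBounds (hG : IsDecaying τ G) :
    ∃ K, ∀ᶠ x in cobounded (Euc (m + 1)), GeometryBounds K τ G x := by
  obtain ⟨K₁, h₁, H₁⟩ := exists_eventually_bound (κ := Fin (m + 1) × Fin (m + 1))
    fun p => (hG.entry_zero p.1 p.2).zero
  obtain ⟨K₂, h₂, H₂⟩ := exists_eventually_bound (κ := Fin (m + 1) × Fin (m + 1))
    fun p => (hG.inv_zero p.1 p.2).zero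
  obtain ⟨K₃, h₃, H₃⟩ := exists_eventually_bound
    (κ := Fin (m + 1) × Fin (m + 1) × Fin (m + 1) × Fin (m + 1))
    fun p => hG.riemann p.1 p.2.1 p.2.2.1 p.2.2.2
  obtain ⟨K₄, h₄, H₄⟩ := exists_eventually_bound (κ := Fin (m + 1) × Fin (m + 1))
    fun p => hG.shapeError p.1 p.2
  refine ⟨K₁ + K₂ + K₃ + K₄, ?_⟩
  filter_upwards [H₁, H₂, H₃, H₄, eventually_lt_norm 1, hG.connectionMap_unitNormal,
    hG.metricAt_unitNormal] with x b₁ b₂ b₃ b₄ hx hc ho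
  have hmono : ∀ {L s : ℝ}, L ≤ K₁ + K₂ + K₃ + K₄ → L * ‖x‖ ^ s ≤ (K₁ + K₂ + K₃ + K₄) * ‖x‖ ^ s :=
    fun h => mul_le_mul_of_nonneg_right h (by positivity)
  refine ⟨hx, by linarith, fun i j => ?_, fun i j => ?_, fun i j k l => ?_, fun l p => ?_, hc, ho⟩
  · simpa using (b₁ (i, j)).trans (hmono (by linarith))
  · simpa using (b₂ (i, j)).trans (hmono (by linarith))
  · exact (b₃ (i, j, k, l)).trans (hmono (by linarith))
  · exact (b₄ (l, p)).trans (hmono (by linarith))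

namespace GeometryBounds
variable {K : ℝ} {x : Euc (m + 1)} {e : Fin (m + 1) → Euc (m + 1)}

theorem abs_metricAt_frame_le (h : GeometryBounds K τ G x)
    (he : IsAdaptedFrame G x (unitNormal G x) e) (a : Fin (m + 1)) (u : Euc (m + 1)) :
    |metricAt G x (e a) u| ≤ ((m + 1 : ℕ) * ((m + 1 : ℕ) * (K * K))) * ‖u‖ := by
  refine (abs_metricAt_le h.entry (he.abs_le h.one_le h.inv a) (b := ‖u‖)
    fun i => by simpa using PiLp.norm_apply_le u i).trans (le_of_eq ?_)
  ring

theorem abs_areaForm_le (h : GeometryBounds K τ G x)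
    (he : IsAdaptedFrame G x (unitNormal G x) e) (X : Fin m → Euc (m + 1)) :
    |areaForm G x X| ≤ m.factorial * ((m + 1 : ℕ) * ((m + 1 : ℕ) * (K * K))) ^ m * ∏ i, ‖X i‖ := by
  rw [areaForm_eq_det he X, abs_mul, abs_pow, abs_neg, abs_one, one_pow, one_mul]
  refine (abs_det_le_prod (N := fun s => ((m + 1 : ℕ) * ((m + 1 : ℕ) * (K * K))) * ‖X s‖)
    fun b s => h.abs_metricAt_frame_le he b.castSucc (X s)).trans (le_of_eq ?_)
  rw [Finset.prod_mul_distrib, Finset.prod_const, Finset.card_univ, Fintype.card_fin]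
  ring

/-- The difference is exactly -g(e_a, w), where w is `shapeError` applied to X. -/
theorem abs_connForm_sub_le (h : GeometryBounds K τ G x)
    (he : IsAdaptedFrame G x (unitNormal G x) e) (a : Fin (m + 1)) {X : Euc (m + 1)}
    (hX : inner ℝ x X = 0) :
    |connForm G x (unitNormal G x) (e a) (X, fderiv ℝ (unitNormal G) x X)
      - -‖x‖⁻¹ * metricAt G x (e a) X|
      ≤ ((m + 1 : ℕ) * ((m + 1 : ℕ) * (K * K)) * ((m + 1 : ℕ) * K)) * ‖x‖ ^ (-τ - 1) * ‖X‖ := by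
  set w : Euc (m + 1) := WithLp.toLp 2 fun l => ∑ p, shapeError G l p x * X p with hw
  have e1 : connForm G x (unitNormal G x) (e a) (X, fderiv ℝ (unitNormal G) x X)
      - -‖x‖⁻¹ * metricAt G x (e a) X = -metricAt G x (e a) w := by
    rw [connForm]
    simp only [metricAt, h.connection X hX, hw]
    simp only [mul_add, Finset.sum_add_distrib]
    have : ∑ i, ∑ j, G x i j * e a i * (‖x‖⁻¹ * X j) = ‖x‖⁻¹ * ∑ i, ∑ j, G x i j * e a i * X j := by
      simp_rw [Finset.mul_sum]
      exact Finset.sum_congr rfl fun i _ => Finset.sum_congr rfl fun j _ => by ring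
    rw [this]
    ring
  rw [e1, abs_neg]
  refine (abs_metricAt_le h.entry (he.abs_le h.one_le h.inv a)
    (b := (m + 1 : ℕ) * (K * ‖x‖ ^ (-τ - 1) * ‖X‖)) fun i => ?_).trans (le_of_eq ?_)
  · refine abs_sum_le_card fun p => ?_
    rw [abs_mul]
    have hK := h.one_le
    exact mul_le_mul (h.shape i p) (by simpa using PiLp.norm_apply_le X p) (abs_nonneg _)
      (by positivity)
  · ring

end GeometryBounds

/-- Here q = n - 1 - 2k: the prefactor r^{n-2k}, k curvature forms, one relative error r^{-τ} and q
one-forms of size 1/r. -/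
theorem rpow_collect {r τ : ℝ} (hr : 0 < r) (k q : ℕ) :
    r ^ (q + 1) * ((r ^ (-τ - 2)) ^ k * (r ^ (-τ) * (r⁻¹) ^ q))
      = r ^ (-((k : ℝ) + 1) * τ - 2 * k + 1) := by
  have h1 : r ^ (q + 1) * (r⁻¹) ^ q = r := by
    rw [pow_succ', mul_assoc, ← mul_pow, mul_inv_cancel₀ hr.ne', one_pow, mul_one]
  have h2 : r * ((r ^ (-τ - 2)) ^ k * r ^ (-τ)) = r ^ (-((k : ℝ) + 1) * τ - 2 * k + 1) := by
    rw [← Real.rpow_mul_natCast hr.le, ← Real.rpow_add hr]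
    nth_rewrite 1 [← Real.rpow_one r]
    rw [← Real.rpow_add hr]
    congr 1
    ring
  rw [← h2]
  linear_combination ((r ^ (-τ - 2)) ^ k * r ^ (-τ)) * h1

/-- The expansion of the pull-back of Chern's form, with the Lovelock curvature taken in the
direction of the unit normal. -/
theorem IsDecaying.pulledChernForm_expansion (hG : IsDecaying τ G) {k : ℕ} (hk : 2 * k ≤ m) :
    ∃ C, ∀ᶠ x in cobounded (Euc (m + 1)), ∀ e, IsAdaptedFrame G x (unitNormal G x) e →
      ∀ X : Fin m → Euc (m + 1), IsTangent x X →
        |‖x‖ ^ (m + 1 - 2 * k) * pulledChernForm hk G x e X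
            - -2 * ((m - 2 * k).factorial : ℝ) *
              (‖x‖ * lovelockAt k G x (unitNormal G x) (unitNormal G x)) * areaForm G x X|
          ≤ C * ‖x‖ ^ (-((k : ℝ) + 1) * τ - 2 * k + 1) * ∏ i, ‖X i‖ := by
  obtain ⟨K, hK⟩ := hG.exists_geometryBounds
  -- The constants bound the coframe (c), the error of the connection forms (B₁) and the curvature
  -- forms (A₀), without their powers of r.
  set c : ℝ := (m + 1 : ℕ) * ((m + 1 : ℕ) * (K * K)) with hc
  set B₁ : ℝ := c * ((m + 1 : ℕ) * K) with hB₁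
  set A₀ : ℝ := (m + 1 : ℕ) * ((m + 1 : ℕ) * (((m + 1 : ℕ) * ((m + 1 : ℕ) * ((m + 1 : ℕ) *
    ((m + 1 : ℕ) * (K * K * K * K * K))))) * (c * c))) with hA₀
  refine ⟨(∑ α : Fin m → Fin m, |genDelta α id|) * (m.factorial *
    (A₀ ^ k * ((m - 2 * k : ℕ) * (c + B₁) ^ (m - 2 * k)))), ?_⟩
  filter_upwards [hK] with x h e he X hX
  have hK1 := h.one_le
  have hr : 0 < ‖x‖ := by linarith [h.one_lt]
  have hc0 : 0 ≤ c := by positivity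
  have hB0 : 0 ≤ B₁ := by positivity
  have horth : ∀ s, metricAt G x (e (Fin.last m)) (X s) = 0 := fun s => by
    rw [he.2.2]
    exact h.orthogonal _ (hX s)
  have hfr := he.abs_le h.one_le h.inv
  have hhle : ‖x‖ ^ (-τ) ≤ 1 :=
    Real.rpow_le_one_of_one_le_of_nonpos h.one_lt.le (by linarith [hG.pos])
  have hsplit : ‖x‖ ^ (-τ - 1) = ‖x‖ ^ (-τ) * ‖x‖⁻¹ := by
    rw [Real.rpow_sub hr, Real.rpow_one, div_eq_mul_inv]
  rw [← leading_term_eq hk (norm_pos_iff.mp hr) he horth fun s => fderiv ℝ (unitNormal G) x (X s),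
    ← mul_sub, abs_mul, abs_of_nonneg (by positivity : 0 ≤ ‖x‖ ^ (m + 1 - 2 * k)), pulledChernForm,
    chernForm, ← Finset.sum_sub_distrib]
  set Z : Fin m → Euc (m + 1) × Euc (m + 1) := fun s => (X s, fderiv ℝ (unitNormal G) x (X s))
    with hZ
  have hlead : ∀ (a : Fin (m + 1)) i,
      |-‖x‖⁻¹ * metricAt G x (e a) (Z i).1| ≤ (c * ‖x‖⁻¹) * ‖X i‖ := by
    intro a i
    rw [abs_mul, abs_neg, abs_of_pos (inv_pos.mpr hr)]
    calc _ ≤ ‖x‖⁻¹ * (c * ‖X i‖) := by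
          gcongr
          exact h.abs_metricAt_frame_le he a (X i)
      _ = _ := by ring
  have hdiff : ∀ (a : Fin (m + 1)) i,
      |connForm G x (unitNormal G x) (e a) (Z i) - -‖x‖⁻¹ * metricAt G x (e a) (Z i).1|
        ≤ B₁ * (‖x‖ ^ (-τ) * ‖x‖⁻¹) * ‖X i‖ := by
    intro a i
    rw [← hsplit]
    exact h.abs_connForm_sub_le he a (hX i)
  have hwedge : ∀ α : Fin m → Fin m,
      |wedge hk
        (fun s => curvForm G x e (α (fstPos hk s)).castSucc (α (sndPos hk s)).castSucc)
        (fun l => connForm G x (unitNormal G x) (e (α (tailPos hk l)).castSucc)) Z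
      - wedge hk
        (fun s => curvForm G x e (α (fstPos hk s)).castSucc (α (sndPos hk s)).castSucc)
        (fun l Z => -‖x‖⁻¹ * metricAt G x (e (α (tailPos hk l)).castSucc) Z.1) Z|
      ≤ m.factorial * ((A₀ * ‖x‖ ^ (-τ - 2)) ^ k * ((m - 2 * k : ℕ) * ‖x‖ ^ (-τ) *
        ((c + B₁) * ‖x‖⁻¹) ^ (m - 2 * k)) * ∏ i, ‖X i‖) := by
    intro α
    -- Both families of one-forms are bounded by (c + B₁)/r because r^{-τ} ≤ 1, and their difference
    -- is at most r^{-τ} times that bound.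
    refine abs_wedge_sub_le hk (N := fun i => ‖X i‖) (by positivity) (fun s i j => ?_)
      (fun l i => ?_) (fun l i => ?_) (fun l i => ?_)
    · refine (abs_curvForm_le hc0
        (fun a b c d => abs_riemannAt_le h.riemann (hfr a) (hfr b) (hfr c) (hfr d))
        (h.abs_metricAt_frame_le he) _ _ _ _).trans (le_of_eq ?_)
      rw [hA₀]
      ring
    · have h1 := hlead (α (tailPos hk l)).castSucc i
      have h2 := hdiff (α (tailPos hk l)).castSucc i
      have h3 : B₁ * (‖x‖ ^ (-τ) * ‖x‖⁻¹) * ‖X i‖ ≤ B₁ * (1 * ‖x‖⁻¹) * ‖X i‖ := by gcongr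
      have h4 := abs_sub_abs_le_abs_sub (connForm G x (unitNormal G x)
        (e (α (tailPos hk l)).castSucc) (Z i))
        (-‖x‖⁻¹ * metricAt G x (e (α (tailPos hk l)).castSucc) (Z i).1)
      linarith
    · refine (hlead _ i).trans ?_
      gcongr
      linarith
    · refine (hdiff _ i).trans ?_
      have : 0 ≤ c * (‖x‖ ^ (-τ) * ‖x‖⁻¹) * ‖X i‖ := by positivity
      linarith
  have hsum := (Finset.abs_sum_le_sum_abs (fun α : Fin m → Fin m => genDelta α id * wedge hk
        (fun s => curvForm G x e (α (fstPos hk s)).castSucc (α (sndPos hk s)).castSucc)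
        (fun l => connForm G x (unitNormal G x) (e (α (tailPos hk l)).castSucc)) Z
      - genDelta α id * wedge hk
        (fun s => curvForm G x e (α (fstPos hk s)).castSucc (α (sndPos hk s)).castSucc)
        (fun l Z => -‖x‖⁻¹ * metricAt G x (e (α (tailPos hk l)).castSucc) Z.1) Z)
        Finset.univ).trans (Finset.sum_le_sum (g := fun α => |genDelta α id| *
      (m.factorial * ((A₀ * ‖x‖ ^ (-τ - 2)) ^ k * ((m - 2 * k : ℕ) * ‖x‖ ^ (-τ) *
        ((c + B₁) * ‖x‖⁻¹) ^ (m - 2 * k)) * ∏ i, ‖X i‖))) fun α _ => by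
      rw [← mul_sub, abs_mul]
      exact mul_le_mul_of_nonneg_left (hwedge α) (abs_nonneg _))
  refine (mul_le_mul_of_nonneg_left hsum (by positivity)).trans (le_of_eq ?_)
  rw [← Finset.sum_mul, ← rpow_collect hr k (m - 2 * k),
    show m + 1 - 2 * k = m - 2 * k + 1 by omega, mul_pow A₀, mul_pow (c + B₁)]
  ring

theorem IsDecaying.exists_abs_areaForm_le (hG : IsDecaying τ G) :
    ∃ C, 0 ≤ C ∧ ∀ᶠ x in cobounded (Euc (m + 1)), ∀ e, IsAdaptedFrame G x (unitNormal G x) e →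
      ∀ X : Fin m → Euc (m + 1), |areaForm G x X| ≤ C * ∏ i, ‖X i‖ := by
  obtain ⟨K, hK⟩ := hG.exists_geometryBounds
  refine ⟨m.factorial * ((m + 1 : ℕ) * ((m + 1 : ℕ) * (K * K))) ^ m, ?_, ?_⟩
  · have := mul_self_nonneg K
    positivity
  · filter_upwards [hK] with x h e he X using h.abs_areaForm_le he X

/-- Replacing the arguments of the Lovelock curvature by nearby vectors in the expansion. -/
theorem IsDecaying.expansion_congr (hG : IsDecaying τ G) {k : ℕ} (hk : 2 * k ≤ m) (b : ℝ)
    {u v : Euc (m + 1) → Euc (m + 1)}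
    (hu : ∀ i, IsSymbol (-τ) fun x => unitNormal G x i - u x i)
    (hv : ∀ i, IsSymbol (-τ) fun x => unitNormal G x i - v x i)
    (hu' : ∀ i, IsSymbol 0 fun x => u x i) (hv' : ∀ i, IsSymbol 0 fun x => v x i) :
    ∃ C, ∀ᶠ x in cobounded (Euc (m + 1)), ∀ e, IsAdaptedFrame G x (unitNormal G x) e →
      ∀ X : Fin m → Euc (m + 1), IsTangent x X →
        |b * (‖x‖ ^ (m + 1 - 2 * k) * pulledChernForm hk G x e X
            - -2 * ((m - 2 * k).factorial : ℝ) *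
              (‖x‖ * lovelockAt k G x (u x) (v x)) * areaForm G x X)|
          ≤ C * ‖x‖ ^ (-((k : ℝ) + 1) * τ - 2 * k + 1) * ∏ i, ‖X i‖ := by
  obtain ⟨C₁, H₁⟩ := hG.pulledChernForm_expansion hk
  obtain ⟨C₂, hC₂, H₂⟩ := hG.exists_abs_areaForm_le
  obtain ⟨C₃, -, H₃⟩ := exists_eventually_bound (κ := Unit) fun _ => hG.lovelockAt_sub k hu hv hu' hv'
  refine ⟨|b| * (C₁ + 2 * ((m - 2 * k).factorial : ℝ) * C₃ * C₂), ?_⟩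
  filter_upwards [H₁, H₂, H₃, eventually_lt_norm 0] with x h₁ h₂ h₃ hr e he X hX
  have h₁ := h₁ e he X hX
  have h₂ := h₂ e he X
  have h₃ := h₃ ()
  have hp : ‖x‖ * ‖x‖ ^ ((k : ℝ) * (-τ - 2) - τ) = ‖x‖ ^ (-((k : ℝ) + 1) * τ - 2 * k + 1) := by
    nth_rewrite 1 [← Real.rpow_one ‖x‖]
    rw [← Real.rpow_add hr]
    congr 1
    ring
  set L := lovelockAt k G x (unitNormal G x) (unitNormal G x) - lovelockAt k G x (u x) (v x) with hL
  have e1 : ‖x‖ ^ (m + 1 - 2 * k) * pulledChernForm hk G x e X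
            - -2 * ((m - 2 * k).factorial : ℝ) *
              (‖x‖ * lovelockAt k G x (u x) (v x)) * areaForm G x X
      = (‖x‖ ^ (m + 1 - 2 * k) * pulledChernForm hk G x e X
            - -2 * ((m - 2 * k).factorial : ℝ) *
              (‖x‖ * lovelockAt k G x (unitNormal G x) (unitNormal G x)) * areaForm G x X)
        - 2 * ((m - 2 * k).factorial : ℝ) * ‖x‖ * (L * areaForm G x X) := by
    rw [hL]
    ring
  have h4 : |2 * ((m - 2 * k).factorial : ℝ) * ‖x‖ * (L * areaForm G x X)|
      ≤ 2 * ((m - 2 * k).factorial : ℝ) * C₃ * C₂ *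
        ‖x‖ ^ (-((k : ℝ) + 1) * τ - 2 * k + 1) * ∏ i, ‖X i‖ := by
    rw [abs_mul, abs_mul L, abs_of_nonneg (by positivity : 0 ≤ 2 * ((m - 2 * k).factorial : ℝ) * ‖x‖)]
    calc _ ≤ 2 * ((m - 2 * k).factorial : ℝ) * ‖x‖ *
          ((C₃ * ‖x‖ ^ ((k : ℝ) * (-τ - 2) - τ)) * (C₂ * ∏ i, ‖X i‖)) := by
            refine mul_le_mul_of_nonneg_left ?_ (by positivity)
            exact mul_le_mul h₃ h₂ (abs_nonneg _) ((abs_nonneg _).trans h₃)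
      _ = _ := by
        rw [← hp]
        ring
  rw [e1, abs_mul]
  refine (mul_le_mul_of_nonneg_left ((abs_sub _ _).trans (add_le_add h₁ h4))
    (abs_nonneg b)).trans (le_of_eq ?_)
  ring

theorem lovelockAt_smul_left {n : ℕ} (k : ℕ) (G : Euc n → Matrix (Fin n) (Fin n) ℝ)
    (x u v : Euc n) (c : ℝ) : lovelockAt k G x (c • u) v = c * lovelockAt k G x u v := by
  simp only [lovelockAt, Finset.mul_sum, PiLp.smul_apply, smul_eq_mul]
  exact Finset.sum_congr rfl fun i _ => Finset.sum_congr rfl fun j _ => by ring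

theorem exists_radius_of_eventually {n : ℕ} {p : Euc n → Prop}
    (h : ∀ᶠ x in cobounded (Euc n), p x) (R : ℝ) :
    ∃ r₀, R < r₀ ∧ ∀ x : Euc n, r₀ ≤ ‖x‖ → p x := by
  obtain ⟨r, -, hr⟩ := (hasBasis_cobounded_norm (E := Euc n)).eventually_iff.mp h
  exact ⟨max r (R + 1), (lt_add_one R).trans_le (le_max_right _ _),
    fun x hx => hr ((le_max_left _ _).trans hx)⟩

/-- The density is at most |C| r^s on a sphere of area proportional to r^m. Monotonicity of `∫⁻`
needs no measurability, so β may involve an arbitrary choice of frames. -/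
theorem tendsto_sphereMass_zero {β : Euc (m + 1) → (Fin m → Euc (m + 1)) → ℝ} {C r₀ s : ℝ}
    (hs : (m : ℝ) + s < 0)
    (hβ : ∀ x : Euc (m + 1), r₀ ≤ ‖x‖ → ∀ X, IsTangent x X →
      |β x X| ≤ C * ‖x‖ ^ s * ∏ i, ‖X i‖) :
    Tendsto (sphereMass β) atTop (𝓝 0) := by
  set μ := (volume : Measure (Euc (m + 1))).toSphere Set.univ with hμ
  have hlim : Tendsto (fun r : ℝ => ENNReal.ofReal (|C| * r ^ ((m : ℝ) + s)) * μ) atTop (𝓝 0) := by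
    have h1 : Tendsto (fun r : ℝ => |C| * r ^ ((m : ℝ) + s)) atTop (𝓝 0) := by
      have := (tendsto_rpow_neg_atTop (y := -((m : ℝ) + s)) (by linarith)).const_mul |C|
      simpa using this
    have h2 := ENNReal.Tendsto.mul_const (b := μ) (ENNReal.tendsto_ofReal h1)
      (Or.inr (measure_ne_top _ _))
    simpa using h2
  refine tendsto_of_tendsto_of_tendsto_of_le_of_le' tendsto_const_nhds hlim
    (Eventually.of_forall fun r => zero_le) ?_
  filter_upwards [eventually_ge_atTop r₀, eventually_gt_atTop 0] with r hr hr0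
  have hnorm : ∀ θ : Metric.sphere (0 : Euc (m + 1)) 1, ‖r • (θ : Euc (m + 1))‖ = r := fun θ => by
    rw [norm_smul, norm_eq_of_mem_sphere, mul_one, Real.norm_of_nonneg hr0.le]
  have hle : ∀ θ : Metric.sphere (0 : Euc (m + 1)) 1,
      tangNorm (r • (θ : Euc (m + 1))) (β (r • (θ : Euc (m + 1)))) ≤ ENNReal.ofReal (|C| * r ^ s) := by
    intro θ
    refine iSup_le fun X => iSup_le fun hX => ENNReal.ofReal_le_ofReal ?_
    refine (hβ _ (by rw [hnorm]; exact hr) X hX.1).trans ?_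
    rw [hnorm]
    have hprod : ∏ i, ‖X i‖ ≤ 1 := Finset.prod_le_one (fun i _ => norm_nonneg _) fun i _ => hX.2 i
    have hprod0 : 0 ≤ ∏ i, ‖X i‖ := Finset.prod_nonneg fun i _ => norm_nonneg _
    calc C * r ^ s * ∏ i, ‖X i‖ ≤ |C| * r ^ s * ∏ i, ‖X i‖ := by
          gcongr
          exact le_abs_self C
      _ ≤ |C| * r ^ s * 1 := by gcongr
      _ = _ := mul_one _
  calc sphereMass β r ≤ ENNReal.ofReal (r ^ m) *
        ∫⁻ _ : Metric.sphere (0 : Euc (m + 1)) 1, ENNReal.ofReal (|C| * r ^ s)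
          ∂(volume : Measure (Euc (m + 1))).toSphere := by
        rw [sphereMass]
        gcongr with θ
        exact hle θ
    _ = ENNReal.ofReal (|C| * r ^ ((m : ℝ) + s)) * μ := by
      rw [lintegral_const, ← mul_assoc, ← ENNReal.ofReal_mul (by positivity)]
      congr 2
      rw [Real.rpow_add hr0, Real.rpow_natCast]
      ring

end Estimates

/-! ### From asymptotically flat charts to the theorem -/

section Main
open Bornology

/-- The rates are part of the definition of the chart; the differentiability that symbols also
require comes from smoothness of g and φ on the exterior region. -/
theorem IsAFChart.isDecaying {n : ℕ} {M : Type*} [TopologicalSpace M] [ChartedSpace (Euc n) M]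
    [IsManifold 𝓘(ℝ, Euc n) ∞ M]
    {g : Bundle.ContMDiffRiemannianMetric 𝓘(ℝ, Euc n) ∞ (Euc n)
      (fun p : M => TangentSpace 𝓘(ℝ, Euc n) p)}
    {τ R : ℝ} {φ : OpenPartialHomeomorph M (Euc n)} (hτ : 0 < τ) (hg : IsAFChart g τ R φ) :
    IsDecaying τ (components g φ) := by
  have hsm : ∀ᶠ x in cobounded (Euc n), ∀ i j,
      ContDiffAt ℝ ∞ (fun y => components g φ y i j) x := by
    filter_upwards [eventually_lt_norm R] with x hx i j
    exact contDiffAt_components g hg.smooth (by rw [hg.target_eq]; exact hx) i j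
  have hd : ∀ i j, ∀ᶠ x in cobounded (Euc n),
      DifferentiableAt ℝ (fun y => components g φ y i j) x := fun i j => by
    filter_upwards [hsm] with x hx using (hx i j).differentiableAt (by simp)
  refine ⟨hτ, fun x i j => components_symm g φ x i j, fun i j => ⟨?_, hg.decay_zero i j, fun p => ?_⟩,
    fun p i j => ⟨?_, hg.decay_one p i j, fun q => ?_⟩⟩
  · filter_upwards [hd i j] with x hx using hx.sub_const _
  · refine (hg.decay_one p i j).congr' ?_ EventuallyEq.rfl
    filter_upwards [hd i j] with x hx
    simp [pd, fderiv_sub_const]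
  · filter_upwards [hsm] with x hx
    have h1 : ContDiffAt ℝ 1 (fderiv ℝ fun y => components g φ y i j) x :=
      (hx i j).fderiv_right (by norm_cast)
    exact (h1.differentiableAt (by simp)).clm_apply (differentiableAt_const _)
  · have h := hg.decay_two q p i j
    rwa [show -τ - 2 = -τ - 1 - 1 by ring] at h

end Main

end ChernMass

theorem lemma6p2 {m k : ℕ} (hk1 : 1 ≤ k) (hk : 2 * k ≤ m)
    {M : Type*} [TopologicalSpace M] [ChartedSpace (Euc (m + 1)) M]
    [IsManifold 𝓘(ℝ, Euc (m + 1)) ∞ M]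
    (g : Bundle.ContMDiffRiemannianMetric 𝓘(ℝ, Euc (m + 1)) ∞ (Euc (m + 1))
      (fun p : M => TangentSpace 𝓘(ℝ, Euc (m + 1)) p))
    (τ R : ℝ) (hτ : 0 < τ) (φ : OpenPartialHomeomorph M (Euc (m + 1)))
    (hg : IsAFChart g τ R φ) :
    -- the expansion, uniformly on the coordinate spheres, in every adapted frame
    (∃ C r₀ : ℝ, R < r₀ ∧ ∀ x : Euc (m + 1), r₀ ≤ ‖x‖ →
      ∀ e, IsAdaptedFrame (components g φ) x (unitNormal (components g φ) x) e →
      ∀ X : Fin m → Euc (m + 1), IsTangent x X →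
        |‖x‖ ^ (m + 1 - 2 * k) * pulledChernForm hk (components g φ) x e X
            - (-2 * ((m - 2 * k).factorial : ℝ) *
              lovelockAt k (components g φ) x (‖x‖ • radial x) (radial x) *
              areaForm (components g φ) x X)|
          ≤ C * ‖x‖ ^ (-((k : ℝ) + 1) * τ - 2 * k + 1) * ∏ i, ‖X i‖) ∧
    -- the integrands of the two masses agree up to terms of the same order
    (∃ C r₀ : ℝ, R < r₀ ∧ ∀ x : Euc (m + 1), r₀ ≤ ‖x‖ →
      ∀ e, IsAdaptedFrame (components g φ) x (unitNormal (components g φ) x) e →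
      ∀ X : Fin m → Euc (m + 1), IsTangent x X →
        |chernMassIntegrand hk (components g φ) x e X
            - intrinsicMassIntegrand k (components g φ) x X|
          ≤ C * ‖x‖ ^ (-((k : ℝ) + 1) * τ - 2 * k + 1) * ∏ i, ‖X i‖) ∧
    -- and their difference vanishes after integration at infinity
    (((m + 1 : ℝ) - 2 * k) / (k + 1) < τ →
      ∀ e : Euc (m + 1) → Fin (m + 1) → Euc (m + 1),
        (∀ x, R < ‖x‖ →
          IsAdaptedFrame (components g φ) x (unitNormal (components g φ) x) (e x)) →
        Tendsto (sphereMass fun x X => chernMassIntegrand hk (components g φ) x (e x) X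
            - intrinsicMassIntegrand k (components g φ) x X) atTop (𝓝 0)) := by
  have hG := hg.isDecaying hτ
  -- The intrinsic mass uses E(r∂_r, ν), so in the second expansion the second argument stays ν.
  have hn : ∀ i, IsSymbol (-τ) fun x => unitNormal (components g φ) x i
      - unitNormal (components g φ) x i := fun i => by simpa using IsSymbol.zero' (-τ)
  have h1 := hG.expansion_congr hk 1 hG.unitNormal_sub_radial hG.unitNormal_sub_radial
    IsDecaying.radial_symbol IsDecaying.radial_symbol
  have h2 := hG.expansion_congr hk (1 / (2 ^ k * (m.factorial : ℝ) * sphereVol (m + 1)))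
    hG.unitNormal_sub_radial hn IsDecaying.radial_symbol hG.unitNormal_zero
  have hdiff : ∀ (x : Euc (m + 1)) e (X : Fin m → Euc (m + 1)),
      chernMassIntegrand hk (components g φ) x e X - intrinsicMassIntegrand k (components g φ) x X
      = 1 / (2 ^ k * (m.factorial : ℝ) * sphereVol (m + 1)) *
        (‖x‖ ^ (m + 1 - 2 * k) * pulledChernForm hk (components g φ) x e X
          - -2 * ((m - 2 * k).factorial : ℝ) *
            (‖x‖ * lovelockAt k (components g φ) x (radial x) (unitNormal (components g φ) x)) *
            areaForm (components g φ) x X) := by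
    intro x e X
    -- The factor 2 of the expansion turns 2^k into 2^{k-1}; truncated subtraction makes k ≥ 1
    -- necessary here.
    have h2k : (2 : ℝ) ^ k = 2 ^ (k - 1) * 2 := by
      rw [← pow_succ, Nat.sub_add_cancel hk1]
    rw [chernMassIntegrand, intrinsicMassIntegrand, lovelockAt_smul_left, h2k]
    ring
  obtain ⟨C₁, H₁⟩ := h1
  obtain ⟨C₂, H₂⟩ := h2
  obtain ⟨r₁, hr₁, B₁⟩ := exists_radius_of_eventually H₁ R
  obtain ⟨r₂, hr₂, B₂⟩ := exists_radius_of_eventually H₂ R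
  refine ⟨⟨C₁, r₁, hr₁, fun x hx e he X hX => ?_⟩, ⟨C₂, r₂, hr₂, fun x hx e he X hX => ?_⟩,
    fun hlt e he => ?_⟩
  · simpa only [one_mul, lovelockAt_smul_left] using B₁ x hx e he X hX
  · rw [hdiff]
    exact B₂ x hx e he X hX
  · refine tendsto_sphereMass_zero (C := C₂) (r₀ := r₂)
      (s := -((k : ℝ) + 1) * τ - 2 * k + 1) ?_ fun x hx X hX => ?_
    -- The exponent m + s equals n - 2k - (k+1)τ.
    · rw [div_lt_iff₀ (by positivity)] at hlt
      linarith
    · rw [hdiff]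
      exact B₂ x hx (e x) (he x (hr₂.trans_le hx)) X hX
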